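/- \textbf{Setting.} Let $\mathbb{R}^{2,3}$ be $\mathbb{R}^5$ with $\langle x,y\rangle=-x_0y_0-x_1y_1+x_2y_2+x_3y_3+x_4y_4$ and its standard orientation $dV$; denote by $e_0,\dots,e_4$ the standard basis. If $X,Y$ span a totally isotropic plane, call $X\wedge Y$ future-directed if $dV(X,Y,e_2,e_3,e_4)>0$. A positively oriented basis $(M_0,\dots,M_4)$ is a \emph{Möbius basis} if its only non-zero scalar products are $\langle M_0,M_4\rangle=\langle M_1,M_1\rangle=-1$, $\langle M_2,M_2\rangle=\langle M_3,M_3\rangle=1$, and $M_0\wedge(M_1+M_2)$ is future-directed. A positively oriented basis $(L_0,\dots,L_4)$ is a \emph{Lie basis} if its only non-zero scalar products are $\langle L_0,L_4\rangle=\langle L_1,L_3\rangle=-1$, $\langle L_2,L_2\rangle=1$, and $L_1\wedge L_0$ is future-directed; equivalently, $L_0=M_0$, $L_1=(M_3-M_1)/\sqrt2$, $L_2=M_2$, $L_3=-(M_1+M_3)/\sqrt2$, $L_4=M_4$ for a Möbius basis $(M_i)$. The Einstein universe is $\mathcal{E}^{1,2}=\{x: x_0^2+x_1^2=1,\ x_2^2+x_3^2+x_4^2=1\}$,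 identified with the set of oriented null lines $[x]$ of $\mathbb{R}^{2,3}$. Let $I$ be a non-empty open interval. A smooth curve $\gamma:I\to\mathcal{E}^{1,2}$ is timelike if $\langle\gamma',\gamma'\rangle<0$ and future-directed if $\gamma_0\gamma_1'-\gamma_1\gamma_0'>0$. Its strain density is $\upsilon_\gamma=\big(\langle\pi(\gamma'''),\pi(\gamma''')\rangle/|\langle\gamma',\gamma'\rangle|\big)^{1/4}$, where $\pi$ is the orthogonal projection onto the orthogonal complement of $\mathrm{span}(\gamma,\gamma',\gamma'')$. A \emph{generic curve} is a smooth future-directed timelike curve with nowhere vanishing strain density. A generic curve $\gamma$ has conformal curvatures $k,h$ (smooth functions on $I$) if there is a smooth family $(M_0,\dots,M_4)$ of Möbius bases along $\gamma$ with $M_0\in\mathbb{R}_{>0}\,\gamma$ and \[ M_0'=\upsilon_\gamma M_1,\quad M_1'=-\upsilon_\gamma(hM_0+M_4),\quad M_2'=\upsilon_\gamma(M_0+kM_3),\quad M_3'=-\upsilon_\gamma kM_2,\quad M_4'=\upsilon_\gamma(hM_1+M_2). \] A change of variable is a smooth bijection between open intervals with nowhere vanishing derivative. A generic curve is maximal if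 it is not, up to a change of variable, a proper restriction of another generic curve. A \emph{homogeneous curve} of class $C\subset\mathbb{R}^2$ is a maximal generic curve whose conformal curvatures are constants $k,h$ with $(k,h)\in C$. The exceptional classes are \begin{align*} C_5&=\{k>1,\ h=-\tfrac1{2k^2}\}, & C_6&=\{0<k<1,\ h=-\tfrac1{2k^2}\}, & C_{7.i}&=\{k>0,\ k^2-2h=-2\},\\ C_{7.ii}&=\{k>1,\ k^2-2h=2\}, & C_8&=\{0<k<1,\ k^2-2h=2\}, & C_9&=\{(1,-\tfrac12)\}. \end{align*} \textbf{Theorem.} Let $\gamma:I\to\mathcal{E}^{1,2}$ be a homogeneous curve of one of the classes $C_5,\dots,C_9$. Then, after a change of variable $I\to\mathbb{R}$, $\gamma$ is parametrized by $\mathbb{R}\ni t\mapsto[\gamma_{(b)}(t)]$, for a basis of the kind indicated and a parameter $b$ in the range indicated, where: \begin{itemize} \item $C_5$ (Möbius basis, $b>1$): $\gamma_{(b)}(t)=\tfrac12(1-b^2t^2)M_0+btM_1+\cos t\,M_2-\sin t\,M_3+M_4$. \item $C_6$ (Möbius basis, $0<b<1$): $\gamma_{(b)}(t)=\tfrac12(1+b^2t^2)M_0+\sinh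 t\,M_1+\cosh t\,M_2+btM_3+M_4$. \item $C_{7.i}$ (Lie basis, $b>1$): $\gamma_{(b)}(t)=\tfrac{(b^2-1)\cos t-t\sin t}{b}L_0-\tfrac{t\cos t+(b^2-1)\sin t}{b}L_1+\sqrt{\tfrac{2(b^2-1)}{b}}\,L_2-\sin t\,L_3+\cos t\,L_4$. \item $C_{7.ii}$ (Lie basis, $b>0$): $\gamma_{(b)}(t)=((1+b^2)\cos t+t\sin t)L_0-b\sin t\,L_1-\sqrt{2b(1+b^2)}\,L_2+(t\cos t-(1+b^2)\sin t)L_3+b\cos t\,L_4$. \item $C_8$ (Lie basis, $0<b<1$): $\gamma_{(b)}(t)=(b-t)e^tL_0-\sqrt{1-b}\,e^tL_1+2\sqrt[4]{b^2(1-b)}\,L_2-(b+t)e^{-t}L_3+\sqrt{1-b}\,e^{-t}L_4$. \item $C_9$ (Lie basis, no parameter): $\gamma(t)=\tfrac{t^4+6t^2-3}{24}L_0+\tfrac{t(t^2+3)}{6}L_1+\tfrac{1+t^2}{2}L_2+tL_3-L_4$. \end{itemize} In the first five cases the parameter $b$ is unique. In all cases, for each $t_0\in I$, the basis (together with $b$)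 is unique among those for which the change of variable can be chosen to send $t_0$ to $0$. -/

import Mathlib

open scoped ContDiff

noncomputable section

namespace ConfLorentz

/-- The space underlying `ℝ^{2,3}`. The coordinates `x 0, …, x 4` of a vector are its coordinates
with respect to the standard Poincaré basis. -/
abbrev R23 : Type := Fin 5 → ℝ

/-- The scalar product of signature `(2,3)`:
`⟨x,y⟩ = -x₀y₀ - x₁y₁ + x₂y₂ + x₃y₃ + x₄y₄`. -/
def scalarProd : LinearMap.BilinForm ℝ R23 :=
  Matrix.toBilin' (Matrix.diagonal ![-1, -1, 1, 1, 1])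

/-- The volume form `dV` of `ℝ^{2,3}`, normalized by the standard Poincaré basis. -/
def volForm (v : Fin 5 → R23) : ℝ := Matrix.det (Matrix.of v)

/-- `X ∧ Y` is a future-directed isotropic bivector: `X`, `Y` span an isotropic plane and
`dV(X, Y, V₁, V₂, V₃) > 0`, where `V₁, V₂, V₃` are the last three vectors of the standard
Poincaré basis. -/
def IsFutureBivector (X Y : R23) : Prop :=
  scalarProd X X = 0 ∧ scalarProd Y Y = 0 ∧ scalarProd X Y = 0 ∧
    0 < volForm ![X, Y, Pi.single 2 1, Pi.single 3 1, Pi.single 4 1]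

/-- The matrix of the scalar product with respect to `B₀, …, B₄`. -/
def gram (B : Fin 5 → R23) : Matrix (Fin 5) (Fin 5) ℝ :=
  Matrix.of fun i j => scalarProd (B i) (B j)

/-- Möbius bases of `ℝ^{2,3}`. -/
structure IsMobiusBasis (B : Fin 5 → R23) : Prop where
  orientation : 0 < volForm B
  gram_eq : gram B = !![ 0,  0, 0, 0, -1;
                         0, -1, 0, 0,  0;
                         0,  0, 1, 0,  0;
                         0,  0, 0, 1,  0;
                        -1,  0, 0, 0,  0]
  future : IsFutureBivector (B 0) (B 1 + B 2)

/-- Lie bases of `ℝ^{2,3}`. The time-orientation condition (`B₁ ∧ B₀` is future-directed) is the one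
for which `(L₀, …, L₄)` is a Lie basis if and only if `L₀ = M₀`, `L₁ = (M₃ - M₁)/√2`, `L₂ = M₂`,
`L₃ = -(M₁ + M₃)/√2`, `L₄ = M₄` for a Möbius basis `(M₀, …, M₄)`. -/
structure IsLieBasis (B : Fin 5 → R23) : Prop where
  orientation : 0 < volForm B
  gram_eq : gram B = !![ 0,  0, 0,  0, -1;
                         0,  0, 0, -1,  0;
                         0,  0, 1,  0,  0;
                         0, -1, 0,  0,  0;
                        -1,  0, 0,  0,  0]
  future : IsFutureBivector (B 1) (B 0)

/-- The Einstein universe `ℰ^{1,2} = S¹ × S²`. -/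
def einsteinUniverse : Set R23 :=
  {x | x 0 ^ 2 + x 1 ^ 2 = 1 ∧ x 2 ^ 2 + x 3 ^ 2 + x 4 ^ 2 = 1}

/-- `x` and `y` span the same oriented line: `[x] = [y]`. -/
def SameOrientedLine (x y : R23) : Prop := ∃ r : ℝ, 0 < r ∧ y = r • x

/-- `γ`, restricted to the open interval `I`, is a smooth future-directed timelike curve of the
Einstein universe. Future-directed means that the time-component `(γ₀, γ₁)` runs counterclockwise
around the unit circle. -/
structure IsTimelikeCurve (γ : ℝ → R23) (I : Set ℝ) : Prop where
  isOpen : IsOpen I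
  ordConnected : I.OrdConnected
  nonempty : I.Nonempty
  smooth : ContDiffOn ℝ ∞ γ I
  mem : ∀ t ∈ I, γ t ∈ einsteinUniverse
  timelike : ∀ t ∈ I, scalarProd (deriv γ t) (deriv γ t) < 0
  future : ∀ t ∈ I, 0 < γ t 0 * deriv γ t 1 - γ t 1 * deriv γ t 0

/-- The conformal osculating space, spanned by `γ`, `γ'`, `γ''`. -/
def osculatingSpace (γ : ℝ → R23) (t : ℝ) : Submodule ℝ R23 :=
  Submodule.span ℝ {γ t, deriv γ t, iteratedDeriv 2 γ t}

/-- The normal conformal space, the orthogonal complement of the osculating space. -/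
def normalSpace (γ : ℝ → R23) (t : ℝ) : Submodule ℝ R23 :=
  scalarProd.orthogonal (osculatingSpace γ t)

open Classical in
/-- The orthogonal projection onto the normal space. The two spaces are complementary along any
timelike curve; the value `0` is used otherwise. -/
def normalProj (γ : ℝ → R23) (t : ℝ) (x : R23) : R23 :=
  if h : IsCompl (normalSpace γ t) (osculatingSpace γ t) then
    (normalSpace γ t).projection (osculatingSpace γ t) h x
  else 0

/-- The strain density of a timelike curve. -/
def strainDensity (γ : ℝ → R23) (t : ℝ) : ℝ :=
  (scalarProd (normalProj γ t (iteratedDeriv 3 γ t)) (normalProj γ t (iteratedDeriv 3 γ t)) /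
    |scalarProd (deriv γ t) (deriv γ t)|) ^ (1 / 4 : ℝ)

/-- Generic timelike curves: future-directed timelike curves without conformal vertices. -/
structure IsGenericCurve (γ : ℝ → R23) (I : Set ℝ) : Prop extends IsTimelikeCurve γ I where
  generic : ∀ t ∈ I, strainDensity γ t ≠ 0

/-- The matrix of the conformal Frenet equations. -/
def frenetMatrix (k h : ℝ) : Matrix (Fin 5) (Fin 5) ℝ :=
  !![0, -h, 1,  0, 0;
     1,  0, 0,  0, h;
     0,  0, 0, -k, 1;
     0,  0, k,  0, 0;
     0, -1, 0,  0, 0]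

/-- `M` is the canonical conformal frame of `γ : I → ℰ^{1,2}`, and the functions `k`, `h` are its
conformal curvatures. -/
structure IsCanonicalFrame (γ : ℝ → R23) (I : Set ℝ) (M : ℝ → Fin 5 → R23) (k h : ℝ → ℝ) :
    Prop where
  smooth : ContDiffOn ℝ ∞ M I
  smooth_k : ContDiffOn ℝ ∞ k I
  smooth_h : ContDiffOn ℝ ∞ h I
  mobius : ∀ t ∈ I, IsMobiusBasis (M t)
  lift : ∀ t ∈ I, SameOrientedLine (γ t) (M t 0)
  frenet : ∀ t ∈ I, ∀ j, deriv (fun s => M s j) t =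
    ∑ i, (frenetMatrix (k t) (h t) i j * strainDensity γ t) • M t i

/-- `φ` is a change of variable of the open interval `I` onto `J`. -/
structure IsChangeOfVariable (φ : ℝ → ℝ) (I J : Set ℝ) : Prop where
  smooth : ContDiffOn ℝ ∞ φ I
  deriv_ne_zero : ∀ t ∈ I, deriv φ t ≠ 0
  bijOn : Set.BijOn φ I J

/-- The generic curve `γ : I → ℰ^{1,2}` is maximal: it is not, up to a change of variable, a proper
restriction of another generic curve. -/
def IsMaximalCurve (γ : ℝ → R23) (I : Set ℝ) : Prop :=
  ∀ (δ : ℝ → R23) (J J' : Set ℝ) (φ : ℝ → ℝ), IsGenericCurve δ J → J' ⊆ J →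
    IsChangeOfVariable φ I J' → (∀ t ∈ I, γ t = δ (φ t)) → J' = J

/-- `γ : I → ℰ^{1,2}` is a (maximal) homogeneous curve of class `C`: a generic curve whose conformal
curvatures are constants `k`, `h` with `(k, h) ∈ C`. -/
structure IsHomogeneousCurve (C : Set (ℝ × ℝ)) (γ : ℝ → R23) (I : Set ℝ) : Prop extends
    IsGenericCurve γ I where
  maximal : IsMaximalCurve γ I
  curvatures : ∃ k h : ℝ, (k, h) ∈ C ∧
    ∃ M : ℝ → Fin 5 → R23, IsCanonicalFrame γ I M (fun _ => k) (fun _ => h)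

/-! The exceptional strata, as sets of pairs `(k, h)`. -/

def C5 : Set (ℝ × ℝ) := {p | 1 < p.1 ∧ p.2 = -(1 / (2 * p.1 ^ 2))}

def C6 : Set (ℝ × ℝ) := {p | 0 < p.1 ∧ p.1 < 1 ∧ p.2 = -(1 / (2 * p.1 ^ 2))}

def C7i : Set (ℝ × ℝ) := {p | 0 < p.1 ∧ p.1 ^ 2 - 2 * p.2 = -2}

def C7ii : Set (ℝ × ℝ) := {p | 1 < p.1 ∧ p.1 ^ 2 - 2 * p.2 = 2}

def C8 : Set (ℝ × ℝ) := {p | 0 < p.1 ∧ p.1 < 1 ∧ p.1 ^ 2 - 2 * p.2 = 2}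

def C9 : Set (ℝ × ℝ) := {(1, -(1 / 2))}

/-! The model curves, for a basis `B₀, …, B₄` of `ℝ^{2,3}`. -/

def curve5 (B : Fin 5 → R23) (b t : ℝ) : R23 :=
  ((1 - b ^ 2 * t ^ 2) / 2) • B 0 + (b * t) • B 1 + Real.cos t • B 2 - Real.sin t • B 3 + B 4

def curve6 (B : Fin 5 → R23) (b t : ℝ) : R23 :=
  ((1 + b ^ 2 * t ^ 2) / 2) • B 0 + Real.sinh t • B 1 + Real.cosh t • B 2 + (b * t) • B 3 + B 4

def curve7i (B : Fin 5 → R23) (b t : ℝ) : R23 :=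
  (((b ^ 2 - 1) * Real.cos t - t * Real.sin t) / b) • B 0
    - ((t * Real.cos t + (b ^ 2 - 1) * Real.sin t) / b) • B 1
    + Real.sqrt (2 * (b ^ 2 - 1) / b) • B 2 - Real.sin t • B 3 + Real.cos t • B 4

def curve7ii (B : Fin 5 → R23) (b t : ℝ) : R23 :=
  ((1 + b ^ 2) * Real.cos t + t * Real.sin t) • B 0 - (b * Real.sin t) • B 1
    - Real.sqrt (2 * b * (1 + b ^ 2)) • B 2
    + (t * Real.cos t - (1 + b ^ 2) * Real.sin t) • B 3 + (b * Real.cos t) • B 4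

def curve8 (B : Fin 5 → R23) (b t : ℝ) : R23 :=
  ((b - t) * Real.exp t) • B 0 - (Real.sqrt (1 - b) * Real.exp t) • B 1
    + (2 * (b ^ 2 * (1 - b)) ^ (1 / 4 : ℝ)) • B 2 - ((b + t) * Real.exp (-t)) • B 3
    + (Real.sqrt (1 - b) * Real.exp (-t)) • B 4

def curve9 (B : Fin 5 → R23) (t : ℝ) : R23 :=
  ((t ^ 4 + 6 * t ^ 2 - 3) / 24) • B 0 + (t * (t ^ 2 + 3) / 6) • B 1 + ((1 + t ^ 2) / 2) • B 2
    + t • B 3 - B 4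

/-- After the change of variable `φ : I → ℝ`, the curve `γ : I → ℰ^{1,2}` is parametrized by
`ℝ ∋ t ↦ [c t]`. -/
def IsParametrizedBy (γ : ℝ → R23) (I : Set ℝ) (φ : ℝ → ℝ) (c : ℝ → R23) : Prop :=
  IsChangeOfVariable φ I Set.univ ∧ ∀ t ∈ I, SameOrientedLine (γ t) (c (φ t))

/-- There are a basis `B` (subject to `isBasis`) and `b ∈ Ω` such that, after a change of variable,
`γ` is parametrized by `t ↦ [c B b t]`. The parameter `b` is unique, and the basis is unique as soon
as the point `t₀` of the curve that corresponds to the value `0` of the new variable is fixed. -/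
def HasUniqueForm (isBasis : (Fin 5 → R23) → Prop) (Ω : Set ℝ)
    (c : (Fin 5 → R23) → ℝ → ℝ → R23) (γ : ℝ → R23) (I : Set ℝ) : Prop :=
  (∃! b : ℝ, b ∈ Ω ∧ ∃ B φ, isBasis B ∧ IsParametrizedBy γ I φ (c B b)) ∧
  ∀ t₀ ∈ I, ∃! p : (Fin 5 → R23) × ℝ, isBasis p.1 ∧ p.2 ∈ Ω ∧
    ∃ φ : ℝ → ℝ, φ t₀ = 0 ∧ IsParametrizedBy γ I φ (c p.1 p.2)

end ConfLorentz

end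

/-!
A curve with constant conformal curvatures `k`, `h` is an orbit of a one-parameter group: in the
parameter `s` with `ds = υ dt`, its canonical frame solves a linear differential equation with
constant coefficients. This decides everything once two facts are known.

* A frame is intrinsic. If `N` is a family of Möbius bases over `γ` that solves the Frenet equations
  with some speed `ρ`, then future-directedness of `γ` forces `ρ > 0`, the strain density is `ρ`
  (`IsAdaptedFrame.strainDensity_eq`), and both `N` and the curvatures are determined by `γ`
  (`IsAdaptedFrame.unique`).
* Solutions of the Frenet equations with the same curvatures and speed agree if they agree at one
  point, and a solution that is a Möbius basis at one point is so everywhere. Instead of matrix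
  exponentials, the proof uses that the tensor `∑ Gᵢⱼ Mᵢ ⊗ Nⱼ` of two solutions is constant
  (`SolvesFrenet.dualGram_eq`), because the Frenet matrix is skew with respect to the Gram matrix.

Now let `c B` be a model curve, `B` a basis of the required kind. A suitable combination of its
derivatives is a frame that solves the Frenet equations on all of `ℝ` with a constant speed, for
certain curvatures (`IsModelFrame`). If `γ` has these curvatures, then choosing `B` such that this
frame at `0` is the canonical frame of `γ` at `t₀`, and `φ` as a multiple of the primitive of the
strain density, makes the two frames agree along `γ`. The model curve is a generic curve on `ℝ`, so
that maximality of `γ` makes `φ` surjective (`IsModelFrame.exists_isParametrizedBy`). Conversely,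
any parametrization of `γ` by a model curve transports the frame of the model to `γ`, and uniqueness
of the frame yields the curvatures, hence `b`, and the basis
(`IsModelFrame.eq_of_isParametrizedBy`).

It remains to find the frames of the six model curves. The frame is determined by the derivatives of
order at most four (`frameOfDerivs`), so that one has to check the fifth-order equation, the scalar
products of the derivatives at `0`, and the two orientations. Time orientations of frames are
compared by `timeMinor_pos_iff`, which replaces the connected components of the isometry group by an
elementary deformation of negative semidefinite planes.
-/

namespace ConfLorentz

open Matrix

/-! ### The scalar product and the time orientation -/

theorem scalarProd_apply (x y : R23) :
    scalarProd x y = -(x 0 * y 0) - x 1 * y 1 + x 2 * y 2 + x 3 * y 3 + x 4 * y 4 := by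
  simp [scalarProd, Matrix.toBilin'_apply', Matrix.mulVec_diagonal, dotProduct,
    Fin.sum_univ_five]
  ring

theorem scalarProd_comm (x y : R23) : scalarProd x y = scalarProd y x := by
  simp only [scalarProd_apply]; ring

/-- The minor `X₀Y₁ - X₁Y₀` of the two timelike coordinates, which measures whether the oriented
plane spanned by `X` and `Y` is future-directed. -/
def timeMinor (X Y : R23) : ℝ := X 0 * Y 1 - X 1 * Y 0

theorem volForm_eq_timeMinor (X Y : R23) :
    volForm ![X, Y, Pi.single 2 1, Pi.single 3 1, Pi.single 4 1] = timeMinor X Y := by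
  simp [volForm, timeMinor, Matrix.det_succ_row_zero, Fin.sum_univ_succ, Fin.succAbove,
    Matrix.submatrix, Pi.single_apply]
  ring

/-- A plane on which the scalar product is negative semidefinite meets the space
`x₀ = x₁ = 0` trivially. -/
theorem timeMinor_ne_zero {X Y : R23}
    (hneg : ∀ p q : ℝ, scalarProd (p • X + q • Y) (p • X + q • Y) ≤ 0)
    (hind : ∀ p q : ℝ, p • X + q • Y = 0 → p = 0 ∧ q = 0) : timeMinor X Y ≠ 0 := by
  intro h
  unfold timeMinor at h
  have key : ∀ p q : ℝ, p * X 0 + q * Y 0 = 0 → p * X 1 + q * Y 1 = 0 → p = 0 ∧ q = 0 := by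
    intro p q h0 h1
    apply hind
    have := hneg p q
    simp only [scalarProd_apply, Pi.add_apply, Pi.smul_apply, smul_eq_mul, h0, h1] at this
    have n2 := mul_self_nonneg (p * X 2 + q * Y 2)
    have n3 := mul_self_nonneg (p * X 3 + q * Y 3)
    have n4 := mul_self_nonneg (p * X 4 + q * Y 4)
    have h2 : p * X 2 + q * Y 2 = 0 := mul_self_eq_zero.1 (by linarith)
    have h3 : p * X 3 + q * Y 3 = 0 := mul_self_eq_zero.1 (by linarith)
    have h4 : p * X 4 + q * Y 4 = 0 := mul_self_eq_zero.1 (by linarith)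
    ext i
    fin_cases i <;> simpa
  obtain ⟨hY0, hX0⟩ := key (Y 0) (-X 0) (by ring) (by linarith)
  obtain ⟨hY1, hX1⟩ := key (Y 1) (-X 1) (by linarith) (by ring)
  have := key 1 0 (by linarith) (by linarith)
  exact one_ne_zero this.1

/-- A continuous function without zeros on a preconnected set has constant sign. -/
theorem pos_iff_pos_of_ne_zero {S : Set ℝ} (hS : IsPreconnected S) {f : ℝ → ℝ}
    (hf : ContinuousOn f S) (h0 : ∀ t ∈ S, f t ≠ 0) {a b : ℝ} (ha : a ∈ S) (hb : b ∈ S) :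
    0 < f a ↔ 0 < f b := by
  have key : ∀ a ∈ S, ∀ b ∈ S, 0 < f a → 0 < f b := by
    intro a ha b hb hpos
    by_contra hle
    push Not at hle
    obtain ⟨t, ht, h⟩ := hS.intermediate_value₂ hb ha hf continuousOn_const hle hpos.le
    exact h0 t ht h
  exact ⟨key a ha b hb, key b hb a ha⟩

/-- Two negative semidefinite planes, spanned by `X, Y` and by the orthogonal vectors `P, Q` of
negative norm, have the same time orientation if the determinant of their mutual scalar products is
positive: contracting the component of `X, Y` orthogonal to `P, Q` deforms one plane into the other
without ever meeting `x₀ = x₁ = 0`. -/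
theorem timeMinor_pos_iff {X Y P Q : R23} (hPQ : scalarProd P Q = 0) (hP : scalarProd P P < 0)
    (hQ : scalarProd Q Q < 0)
    (hneg : ∀ p q : ℝ, scalarProd (p • X + q • Y) (p • X + q • Y) ≤ 0)
    (hD : 0 < scalarProd X P * scalarProd Y Q - scalarProd X Q * scalarProd Y P) :
    0 < timeMinor X Y ↔ 0 < timeMinor P Q := by
  set a := scalarProd X P / scalarProd P P with ha
  set b := scalarProd X Q / scalarProd Q Q with hb
  set a' := scalarProd Y P / scalarProd P P with ha'
  set b' := scalarProd Y Q / scalarProd Q Q with hb'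
  set X0 : R23 := a • P + b • Q with hX0
  set Y0 : R23 := a' • P + b' • Q with hY0
  set X1 : R23 := X - X0 with hX1
  set Y1 : R23 := Y - Y0 with hY1
  have hQP : scalarProd Q P = 0 := by rw [scalarProd_comm, hPQ]
  have hXP : scalarProd X P = a * scalarProd P P := (div_mul_cancel₀ _ hP.ne).symm
  have hXQ : scalarProd X Q = b * scalarProd Q Q := (div_mul_cancel₀ _ hQ.ne).symm
  have hYP : scalarProd Y P = a' * scalarProd P P := (div_mul_cancel₀ _ hP.ne).symm
  have hYQ : scalarProd Y Q = b' * scalarProd Q Q := (div_mul_cancel₀ _ hQ.ne).symm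
  have hdet : 0 < a * b' - b * a' := by
    have h1 : 0 < (a * b' - b * a') * (scalarProd P P * scalarProd Q Q) := by
      rw [hXP, hXQ, hYP, hYQ] at hD; linarith
    exact pos_of_mul_pos_left h1 (mul_pos_of_neg_of_neg hP hQ).le
  -- The form on the plane deformed by `c` is a convex combination, with weights `1 - c²` and `c²`,
  -- of a negative definite form and of the form on the given plane.
  have hform : ∀ c p q : ℝ,
      scalarProd (p • (X0 + c • X1) + q • (Y0 + c • Y1)) (p • (X0 + c • X1) + q • (Y0 + c • Y1)) =
      (1 - c ^ 2) * ((p * a + q * a') ^ 2 * scalarProd P P + (p * b + q * b') ^ 2 * scalarProd Q Q)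
        + c ^ 2 * scalarProd (p • X + q • Y) (p • X + q • Y) := by
    intro c p q
    have hPX := scalarProd_comm P X
    have hPY := scalarProd_comm P Y
    have hQX := scalarProd_comm Q X
    have hQY := scalarProd_comm Q Y
    simp only [hX1, hY1, hX0, hY0, map_add, map_sub, map_smul, LinearMap.add_apply,
      LinearMap.sub_apply, LinearMap.smul_apply, smul_eq_mul, hPX, hPY, hQX, hQY, hXP, hXQ, hYP,
      hYQ, hPQ, hQP]
    ring
  have hne : ∀ c ∈ Set.Icc (0 : ℝ) 1, timeMinor (X0 + c • X1) (Y0 + c • Y1) ≠ 0 := by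
    rintro c ⟨hc0, hc1⟩
    have hc2 : 0 ≤ 1 - c ^ 2 := by nlinarith
    refine timeMinor_ne_zero (fun p q => ?_) (fun p q hpq => ?_)
    · rw [hform]
      have h1 : (p * a + q * a') ^ 2 * scalarProd P P + (p * b + q * b') ^ 2 * scalarProd Q Q ≤ 0 :=
        add_nonpos (mul_nonpos_of_nonneg_of_nonpos (sq_nonneg _) hP.le)
          (mul_nonpos_of_nonneg_of_nonpos (sq_nonneg _) hQ.le)
      exact add_nonpos (mul_nonpos_of_nonneg_of_nonpos hc2 h1)
        (mul_nonpos_of_nonneg_of_nonpos (sq_nonneg _) (hneg p q))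
    · have e1 : (p * a + q * a') * scalarProd P P = 0 := by
        have := congrArg (fun z => scalarProd z P) hpq
        simp only [hX1, hY1, hX0, hY0, map_add, map_sub, map_smul, LinearMap.add_apply,
          LinearMap.sub_apply, LinearMap.smul_apply, smul_eq_mul, hXP, hYP,
          hQP, map_zero, LinearMap.zero_apply] at this
        linear_combination this
      have e2 : (p * b + q * b') * scalarProd Q Q = 0 := by
        have := congrArg (fun z => scalarProd z Q) hpq
        simp only [hX1, hY1, hX0, hY0, map_add, map_sub, map_smul, LinearMap.add_apply,
          LinearMap.sub_apply, LinearMap.smul_apply, smul_eq_mul, hXQ, hYQ,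
          hPQ, map_zero, LinearMap.zero_apply] at this
        linear_combination this
      replace e1 := (mul_eq_zero.1 e1).resolve_right hP.ne
      replace e2 := (mul_eq_zero.1 e2).resolve_right hQ.ne
      constructor
      · have : p * (a * b' - b * a') = 0 := by linear_combination b' * e1 - a' * e2
        exact (mul_eq_zero.1 this).resolve_right hdet.ne'
      · have : q * (a * b' - b * a') = 0 := by linear_combination a * e2 - b * e1
        exact (mul_eq_zero.1 this).resolve_right hdet.ne'
  have hcont : ContinuousOn (fun c : ℝ => timeMinor (X0 + c • X1) (Y0 + c • Y1))
      (Set.Icc (0 : ℝ) 1) := by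
    simp only [timeMinor, Pi.add_apply, Pi.smul_apply, smul_eq_mul]
    fun_prop
  have h := pos_iff_pos_of_ne_zero isPreconnected_Icc hcont hne (Set.right_mem_Icc.2 zero_le_one)
    (Set.left_mem_Icc.2 zero_le_one)
  have e1 : timeMinor (X0 + (1 : ℝ) • X1) (Y0 + (1 : ℝ) • Y1) = timeMinor X Y := by
    simp [hX1, hY1]
  have e0 : timeMinor (X0 + (0 : ℝ) • X1) (Y0 + (0 : ℝ) • Y1) =
      (a * b' - b * a') * timeMinor P Q := by
    simp only [hX0, hY0, timeMinor, Pi.add_apply, Pi.smul_apply, smul_eq_mul]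
    ring
  simp only [e1, e0] at h
  rw [h, mul_pos_iff_of_pos_left hdet]

/-! ### Möbius and Lie bases -/

/-- The Gram matrix of a Möbius basis. -/
def mobiusGram : Matrix (Fin 5) (Fin 5) ℝ :=
  !![0, 0, 0, 0, -1; 0, -1, 0, 0, 0; 0, 0, 1, 0, 0; 0, 0, 0, 1, 0; -1, 0, 0, 0, 0]

/-- The Gram matrix of a Lie basis. -/
def lieGram : Matrix (Fin 5) (Fin 5) ℝ :=
  !![0, 0, 0, 0, -1; 0, 0, 0, -1, 0; 0, 0, 1, 0, 0; 0, -1, 0, 0, 0; -1, 0, 0, 0, 0]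

/-- The Gram matrix of the standard basis. -/
def stdGram : Matrix (Fin 5) (Fin 5) ℝ := Matrix.diagonal ![-1, -1, 1, 1, 1]

theorem mobiusGram_mul_self : mobiusGram * mobiusGram = 1 := by
  ext i j
  fin_cases i <;> fin_cases j <;> simp [mobiusGram, Matrix.mul_apply, Fin.sum_univ_five]

theorem stdGram_mul_self : stdGram * stdGram = 1 := by
  rw [stdGram, Matrix.diagonal_mul_diagonal, ← Matrix.diagonal_one]
  congr 1
  ext i
  fin_cases i <;> simp

theorem gram_eq_mul (B : Fin 5 → R23) :
    gram B = Matrix.of B * stdGram * (Matrix.of B)ᵀ := by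
  ext i j
  simp [gram, scalarProd_apply, stdGram, Matrix.mul_apply, Fin.sum_univ_five]
  ring

/-- The family `∑ⱼ Eᵢⱼ Bⱼ`, whose `i`-th vector has as coordinates the `i`-th row of `E`. -/
def comb (E : Matrix (Fin 5) (Fin 5) ℝ) (B : Fin 5 → R23) : Fin 5 → R23 :=
  fun i => ∑ j, E i j • B j

theorem of_comb (E : Matrix (Fin 5) (Fin 5) ℝ) (B : Fin 5 → R23) :
    Matrix.of (comb E B) = E * Matrix.of B := by
  ext i a
  simp [comb, Matrix.mul_apply]

theorem gram_comb (E : Matrix (Fin 5) (Fin 5) ℝ) (B : Fin 5 → R23) :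
    gram (comb E B) = E * gram B * Eᵀ := by
  simp only [gram_eq_mul, of_comb, Matrix.transpose_mul, Matrix.mul_assoc]

theorem volForm_comb (E : Matrix (Fin 5) (Fin 5) ℝ) (B : Fin 5 → R23) :
    volForm (comb E B) = E.det * volForm B := by
  rw [volForm, of_comb, Matrix.det_mul, volForm]

theorem comb_inv_comb {E : Matrix (Fin 5) (Fin 5) ℝ} (hE : IsUnit E.det) (B : Fin 5 → R23) :
    comb E (comb E⁻¹ B) = B := by
  apply Matrix.of.injective
  rw [of_comb, of_comb, ← Matrix.mul_assoc, Matrix.mul_nonsing_inv E hE, Matrix.one_mul]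

theorem comb_injective {E : Matrix (Fin 5) (Fin 5) ℝ} (hE : IsUnit E.det) :
    Function.Injective (comb E) := by
  intro B B' h
  have h1 := congrArg Matrix.of h
  rw [of_comb, of_comb] at h1
  exact Matrix.of.injective (((Matrix.isUnit_iff_isUnit_det E).2 hE).mul_right_injective h1)

theorem scalarProd_comb_left (E : Matrix (Fin 5) (Fin 5) ℝ) (B : Fin 5 → R23) (i : Fin 5)
    (v : R23) : scalarProd (comb E B i) v = ∑ j, E i j * scalarProd (B j) v := by
  simp [comb]

theorem scalarProd_of_gram {B : Fin 5 → R23} {G : Matrix (Fin 5) (Fin 5) ℝ} (h : gram B = G)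
    (i j : Fin 5) : scalarProd (B i) (B j) = G i j := by
  rw [← h]; rfl

theorem timeMinor_zero_one_pos_iff {N : Fin 5 → R23} (hN : gram N = mobiusGram) :
    0 < timeMinor (N 0) (N 1) ↔ 0 < timeMinor (N 0 + N 4) (N 1) := by
  have g := scalarProd_of_gram hN
  refine timeMinor_pos_iff ?_ ?_ ?_ (fun p q => ?_) ?_ <;>
    simp [g, mobiusGram]
  nlinarith [mul_self_nonneg q]

theorem isFutureBivector_mobius_iff {N : Fin 5 → R23} (hN : gram N = mobiusGram) :
    IsFutureBivector (N 0) (N 1 + N 2) ↔ 0 < timeMinor (N 0 + N 4) (N 1) := by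
  have g := scalarProd_of_gram hN
  rw [← timeMinor_pos_iff (X := N 0) (Y := N 1 + N 2), IsFutureBivector, volForm_eq_timeMinor]
  · simp [g, mobiusGram]
  · simp [g, mobiusGram]
  · simp [g, mobiusGram]
  · simp [g, mobiusGram]
  · intro p q
    simp [g, mobiusGram]
  · simp [g, mobiusGram]

theorem isFutureBivector_lie_iff {B : Fin 5 → R23} (hB : gram B = lieGram) :
    IsFutureBivector (B 1) (B 0) ↔ 0 < timeMinor (B 1 + B 3) (B 0 + B 4) := by
  have g := scalarProd_of_gram hB
  rw [← timeMinor_pos_iff (X := B 1) (Y := B 0), IsFutureBivector, volForm_eq_timeMinor]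
  · simp [g, lieGram]
  · simp [g, lieGram]
  · simp [g, lieGram]
  · simp [g, lieGram]
  · intro p q
    simp [g, lieGram]
  · simp [g, lieGram]

theorem isMobiusBasis_iff {N : Fin 5 → R23} : IsMobiusBasis N ↔
    gram N = mobiusGram ∧ 0 < volForm N ∧ 0 < timeMinor (N 0 + N 4) (N 1) :=
  ⟨fun h => ⟨h.gram_eq, h.orientation, (isFutureBivector_mobius_iff h.gram_eq).1 h.future⟩,
    fun h => ⟨h.2.1, h.1, (isFutureBivector_mobius_iff h.1).2 h.2.2⟩⟩

theorem isLieBasis_iff {B : Fin 5 → R23} : IsLieBasis B ↔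
    gram B = lieGram ∧ 0 < volForm B ∧ 0 < timeMinor (B 1 + B 3) (B 0 + B 4) :=
  ⟨fun h => ⟨h.gram_eq, h.orientation, (isFutureBivector_lie_iff h.gram_eq).1 h.future⟩,
    fun h => ⟨h.2.1, h.1, (isFutureBivector_lie_iff h.1).2 h.2.2⟩⟩

theorem IsMobiusBasis.timeMinor_pos {N : Fin 5 → R23} (h : IsMobiusBasis N) :
    0 < timeMinor (N 0) (N 1) :=
  (timeMinor_zero_one_pos_iff h.gram_eq).2 (isMobiusBasis_iff.1 h).2.2

theorem gram_comb_eq_iff {E G G' : Matrix (Fin 5) (Fin 5) ℝ} {B : Fin 5 → R23}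
    (hE : IsUnit E.det) (h : E * G * Eᵀ = G') : gram (comb E B) = G' ↔ gram B = G := by
  rw [gram_comb, ← h]
  have hE' : IsUnit E := (Matrix.isUnit_iff_isUnit_det E).2 hE
  have hEt : IsUnit Eᵀ := (Matrix.isUnit_iff_isUnit_det _).2 (by rwa [Matrix.det_transpose])
  rw [hEt.mul_left_inj, hE'.mul_right_inj]

theorem timeMinor_pos_iff_of_gram {N : Fin 5 → R23} (hN : gram N = mobiusGram)
    {P Q : R23} (hPQ : scalarProd P Q = 0) (hP : scalarProd P P < 0) (hQ : scalarProd Q Q < 0)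
    (hD : 0 < scalarProd (N 0 + N 4) P * scalarProd (N 1) Q -
      scalarProd (N 0 + N 4) Q * scalarProd (N 1) P) :
    0 < timeMinor (N 0 + N 4) (N 1) ↔ 0 < timeMinor P Q := by
  have g := scalarProd_of_gram hN
  refine timeMinor_pos_iff hPQ hP hQ (fun p q => ?_) hD
  simp [g, mobiusGram]
  nlinarith [mul_self_nonneg q, mul_self_nonneg p]

/-- A matrix taking the Gram matrix of Möbius bases to itself and preserving both orientations
acts on Möbius bases. -/
theorem isMobiusBasis_comb_iff {E : Matrix (Fin 5) (Fin 5) ℝ} {B : Fin 5 → R23}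
    (hG : E * mobiusGram * Eᵀ = mobiusGram) (hdet : 0 < E.det)
    (ht : 0 < (E 0 0 + E 4 0 + E 0 4 + E 4 4) * E 1 1 - (E 0 1 + E 4 1) * (E 1 0 + E 1 4)) :
    IsMobiusBasis (comb E B) ↔ IsMobiusBasis B := by
  have key := gram_comb_eq_iff (B := B) hdet.ne'.isUnit hG
  rw [isMobiusBasis_iff, isMobiusBasis_iff, key, volForm_comb, mul_pos_iff_of_pos_left hdet]
  refine and_congr_right fun hB => and_congr_right fun _ => ?_
  have g := scalarProd_of_gram hB
  refine timeMinor_pos_iff_of_gram (key.2 hB) ?_ ?_ ?_ ?_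
  · simp [g, mobiusGram]
  · simp [g, mobiusGram]
  · simp [g, mobiusGram]
  · simp only [map_add, LinearMap.add_apply, scalarProd_comb_left, g, Fin.sum_univ_five]
    simp [mobiusGram]
    linarith

/-- A matrix taking the Gram matrix of Lie bases to that of Möbius bases and preserving both
orientations takes Lie bases to Möbius bases. -/
theorem isMobiusBasis_comb_iff_isLieBasis {E : Matrix (Fin 5) (Fin 5) ℝ} {B : Fin 5 → R23}
    (hG : E * lieGram * Eᵀ = mobiusGram) (hdet : 0 < E.det)
    (ht : 0 < (E 0 1 + E 4 1 + E 0 3 + E 4 3) * (E 1 0 + E 1 4) -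
      (E 0 0 + E 4 0 + E 0 4 + E 4 4) * (E 1 1 + E 1 3)) :
    IsMobiusBasis (comb E B) ↔ IsLieBasis B := by
  have key := gram_comb_eq_iff (B := B) hdet.ne'.isUnit hG
  rw [isMobiusBasis_iff, isLieBasis_iff, key, volForm_comb, mul_pos_iff_of_pos_left hdet]
  refine and_congr_right fun hB => and_congr_right fun _ => ?_
  have g := scalarProd_of_gram hB
  refine timeMinor_pos_iff_of_gram (key.2 hB) ?_ ?_ ?_ ?_
  · simp [g, lieGram]
  · simp [g, lieGram]
  · simp [g, lieGram]
  · simp only [map_add, LinearMap.add_apply, scalarProd_comb_left, g, Fin.sum_univ_five]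
    simp [lieGram]
    linarith

/-! ### Expansion in a Möbius basis -/

/-- The tensor `∑ᵢⱼ Gᵢⱼ Mᵢ ⊗ Nⱼ`, where `G` is the Gram matrix of Möbius bases. It is the inverse
metric for `M = N` exactly if `G` is the Gram matrix of `N`. -/
def dualGram (M N : Fin 5 → R23) : Matrix (Fin 5) (Fin 5) ℝ :=
  (Matrix.of M)ᵀ * mobiusGram * Matrix.of N

theorem dualGram_apply (M N : Fin 5 → R23) (a b : Fin 5) :
    dualGram M N a b = -(M 0 a * N 4 b) - M 4 a * N 0 b - M 1 a * N 1 b + M 2 a * N 2 b +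
      M 3 a * N 3 b := by
  simp [dualGram, Matrix.mul_apply, mobiusGram, Fin.sum_univ_five]
  ring

theorem dualGram_self_iff {N : Fin 5 → R23} :
    dualGram N N = stdGram ↔ gram N = mobiusGram := by
  rw [gram_eq_mul, dualGram]
  generalize Matrix.of N = N
  constructor
  · intro h
    have h1 : (stdGram * Nᵀ * mobiusGram) * N = 1 := by
      rw [Matrix.mul_assoc stdGram, Matrix.mul_assoc stdGram, h, stdGram_mul_self]
    have h2 := mul_eq_one_comm.1 h1
    calc N * stdGram * Nᵀ = N * (stdGram * Nᵀ * mobiusGram) * mobiusGram := by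
          simp only [Matrix.mul_assoc, mobiusGram_mul_self, Matrix.mul_one]
      _ = mobiusGram := by rw [h2, Matrix.one_mul]
  · intro h
    have h1 : (mobiusGram * N * stdGram) * Nᵀ = 1 := by
      rw [Matrix.mul_assoc mobiusGram, Matrix.mul_assoc mobiusGram, h, mobiusGram_mul_self]
    have h2 := mul_eq_one_comm.1 h1
    calc Nᵀ * mobiusGram * N = Nᵀ * (mobiusGram * N * stdGram) * stdGram := by
          simp only [Matrix.mul_assoc, stdGram_mul_self, Matrix.mul_one]
      _ = stdGram := by rw [h2, Matrix.one_mul]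

theorem eq_of_dualGram {M N : Fin 5 → R23} (hN : dualGram N N = stdGram)
    (h : dualGram M N = stdGram) : M = N := by
  apply Matrix.of.injective
  rw [dualGram] at hN h
  generalize Matrix.of M = M at h ⊢
  generalize Matrix.of N = N at h hN ⊢
  have h1 : Nᵀ * (mobiusGram * N * stdGram) = 1 := by
    rw [← Matrix.mul_assoc, ← Matrix.mul_assoc, hN, stdGram_mul_self]
  have h2 : Mᵀ * (mobiusGram * N * stdGram) = 1 := by
    rw [← Matrix.mul_assoc, ← Matrix.mul_assoc, h, stdGram_mul_self]
  have h3 : Mᵀ = Nᵀ := by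
    calc Mᵀ = Mᵀ * ((mobiusGram * N * stdGram) * Nᵀ) := by
          rw [mul_eq_one_comm.1 h1, Matrix.mul_one]
      _ = Nᵀ := by rw [← Matrix.mul_assoc, h2, Matrix.one_mul]
  exact Matrix.transpose_injective h3

theorem expand_mobius {N : Fin 5 → R23} (hN : gram N = mobiusGram) (x : R23) :
    x = (-scalarProd x (N 4)) • N 0 + (-scalarProd x (N 1)) • N 1 + scalarProd x (N 2) • N 2 +
      scalarProd x (N 3) • N 3 + (-scalarProd x (N 0)) • N 4 := by
  have h1 : ∀ b a, dualGram N N b a = stdGram b a := fun b a => by rw [dualGram_self_iff.2 hN]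
  simp only [dualGram_apply] at h1
  ext a
  have e0 := h1 0 a
  have e1 := h1 1 a
  have e2 := h1 2 a
  have e3 := h1 3 a
  have e4 := h1 4 a
  simp only [scalarProd_apply, Pi.add_apply, Pi.smul_apply, smul_eq_mul]
  fin_cases a <;> simp [stdGram] at e0 e1 e2 e3 e4 ⊢ <;>
    linear_combination x 0 * e0 + x 1 * e1 - x 2 * e2 - x 3 * e3 - x 4 * e4

/-! ### The Frenet equations with constant curvatures -/

/-- On `I`, the family `N` solves the conformal Frenet equations with constant curvatures `k`, `h`
and speed `ρ`, which need not be the strain density of a curve. -/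
structure SolvesFrenet (k h : ℝ) (ρ : ℝ → ℝ) (I : Set ℝ) (N : ℝ → Fin 5 → R23) : Prop where
  zero : ∀ t ∈ I, HasDerivAt (fun s => N s 0) (ρ t • N t 1) t
  one : ∀ t ∈ I, HasDerivAt (fun s => N s 1) (-ρ t • (h • N t 0 + N t 4)) t
  two : ∀ t ∈ I, HasDerivAt (fun s => N s 2) (ρ t • (N t 0 + k • N t 3)) t
  three : ∀ t ∈ I, HasDerivAt (fun s => N s 3) (-(ρ t * k) • N t 2) t
  four : ∀ t ∈ I, HasDerivAt (fun s => N s 4) (ρ t • (h • N t 1 + N t 2)) t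

namespace SolvesFrenet

variable {k h : ℝ} {ρ : ℝ → ℝ} {I : Set ℝ} {M N : ℝ → Fin 5 → R23}

theorem hasDerivAt (hN : SolvesFrenet k h ρ I N) {t : ℝ} (ht : t ∈ I) (j : Fin 5) :
    HasDerivAt (fun s => N s j)
      (![ρ t • N t 1, -ρ t • (h • N t 0 + N t 4), ρ t • (N t 0 + k • N t 3), -(ρ t * k) • N t 2,
        ρ t • (h • N t 1 + N t 2)] j) t := by
  fin_cases j
  exacts [hN.zero t ht, hN.one t ht, hN.two t ht, hN.three t ht, hN.four t ht]

theorem continuousOn (hN : SolvesFrenet k h ρ I N) : ContinuousOn N I :=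
  continuousOn_pi.2 fun j _ ht => (hN.hasDerivAt ht j).continuousAt.continuousWithinAt

theorem contDiffOn (hN : SolvesFrenet k h ρ I N) (hI : IsOpen I) (hρ : ContDiffOn ℝ ∞ ρ I)
    (j : Fin 5) : ContDiffOn ℝ ∞ (fun s => N s j) I := by
  rw [contDiffOn_infty]
  intro n
  induction n generalizing j with
  | zero =>
    exact contDiffOn_zero.2 fun _ ht => (hN.hasDerivAt ht j).continuousAt.continuousWithinAt
  | succ n ih =>
    have hρn : ContDiffOn ℝ n ρ I := contDiffOn_infty.1 hρ n
    push_cast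
    rw [contDiffOn_succ_iff_deriv_of_isOpen hI]
    refine ⟨fun t ht => (hN.hasDerivAt ht j).differentiableAt.differentiableWithinAt,
      by simp, ContDiffOn.congr ?_ fun t ht => (hN.hasDerivAt ht j).deriv⟩
    fin_cases j
    · exact hρn.smul (ih 1)
    · exact hρn.neg.smul (((ih 0).const_smul h).add (ih 4))
    · exact hρn.smul ((ih 0).add ((ih 3).const_smul k))
    · exact (hρn.mul contDiffOn_const).neg.smul (ih 2)
    · exact hρn.smul (((ih 1).const_smul h).add (ih 2))

/-- The matrix of the Frenet equations lies in the Lie algebra of the isometry group, so that the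
tensor `dualGram` of two solutions is constant. -/
theorem dualGram_eq (hM : SolvesFrenet k h ρ I M) (hN : SolvesFrenet k h ρ I N) (hI : IsOpen I)
    (hc : IsPreconnected I) {s t : ℝ} (hs : s ∈ I) (ht : t ∈ I) :
    dualGram (M s) (N s) = dualGram (M t) (N t) := by
  ext a b
  have key : ∀ u ∈ I, HasDerivAt (fun u => dualGram (M u) (N u) a b) 0 u := by
    intro u hu
    have m : ∀ j, _ := fun j => hasDerivAt_pi.1 (hM.hasDerivAt hu j) a
    have n : ∀ j, _ := fun j => hasDerivAt_pi.1 (hN.hasDerivAt hu j) b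
    simp only [dualGram_apply]
    refine ((((((m 0).mul (n 4)).neg.sub ((m 4).mul (n 0))).sub ((m 1).mul (n 1))).add
      ((m 2).mul (n 2))).add ((m 3).mul (n 3))).congr_deriv ?_
    simp
    ring
  exact hI.is_const_of_deriv_eq_zero hc
    (fun u hu => (key u hu).differentiableAt.differentiableWithinAt)
    (fun u hu => (key u hu).deriv) hs ht

theorem gram_eq (hN : SolvesFrenet k h ρ I N) (hI : IsOpen I) (hc : IsPreconnected I) {s t : ℝ}
    (hs : s ∈ I) (ht : t ∈ I) (h0 : gram (N s) = mobiusGram) : gram (N t) = mobiusGram := by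
  rw [← dualGram_self_iff] at h0 ⊢
  rw [hN.dualGram_eq hN hI hc ht hs, h0]

theorem eqOn (hM : SolvesFrenet k h ρ I M) (hN : SolvesFrenet k h ρ I N) (hI : IsOpen I)
    (hc : IsPreconnected I) {s t : ℝ} (hs : s ∈ I) (ht : t ∈ I) (h0 : gram (N s) = mobiusGram)
    (hMN : M s = N s) : M t = N t := by
  rw [← dualGram_self_iff] at h0
  apply eq_of_dualGram
  · rw [hN.dualGram_eq hN hI hc ht hs, h0]
  · rw [hM.dualGram_eq hN hI hc ht hs, hMN, h0]

/-- A solution that is a Möbius basis once is so forever: by continuity it cannot leave its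
component of the set of families with the Gram matrix of a Möbius basis. -/
theorem isMobiusBasis (hN : SolvesFrenet k h ρ I N) (hI : IsOpen I) (hc : IsPreconnected I)
    {s t : ℝ} (hs : s ∈ I) (ht : t ∈ I) (h0 : IsMobiusBasis (N s)) : IsMobiusBasis (N t) := by
  rw [isMobiusBasis_iff] at h0 ⊢
  have hg : ∀ u ∈ I, gram (N u) = mobiusGram := fun u hu => hN.gram_eq hI hc hs hu h0.1
  have hcN := hN.continuousOn
  refine ⟨hg t ht, (pos_iff_pos_of_ne_zero hc
      (f := fun u => volForm (N u)) ?_ (fun u hu => ?_) hs ht).1 h0.2.1,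
    (timeMinor_zero_one_pos_iff (hg t ht)).1 <| (pos_iff_pos_of_ne_zero hc
      (f := fun u => timeMinor (N u 0) (N u 1)) ?_ (fun u hu => ?_) hs ht).1 <|
    (timeMinor_zero_one_pos_iff h0.1).2 h0.2.2⟩
  · exact (Continuous.matrix_det (A := fun V : Fin 5 → R23 => Matrix.of V)
      continuous_id).comp_continuousOn hcN
  · intro hdet
    have h1 : (gram (N u)).det = 0 := by
      rw [gram_eq_mul, Matrix.det_mul, Matrix.det_mul, show (Matrix.of (N u)).det = 0 from hdet]
      simp
    have h2 := congrArg Matrix.det mobiusGram_mul_self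
    rw [Matrix.det_mul, ← hg u hu, h1] at h2
    simp at h2
  · unfold timeMinor
    have c : ∀ j a, ContinuousOn (fun u => N u j a) I := fun j a =>
      (continuous_apply_apply j a).comp_continuousOn hcN
    exact ((c 0 0).mul (c 1 1)).sub ((c 0 1).mul (c 1 0))
  · have g := scalarProd_of_gram (hg u hu)
    refine timeMinor_ne_zero (fun p q => ?_) (fun p q hpq => ?_)
    · simp [g, mobiusGram]
      exact mul_self_nonneg q
    · have e1 := congrArg (fun z => scalarProd z (N u 4)) hpq
      have e2 := congrArg (fun z => scalarProd z (N u 1)) hpq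
      simp [g, mobiusGram] at e1 e2
      exact ⟨e1, e2⟩

theorem comp {φ : ℝ → ℝ} {J : Set ℝ} {φ' : ℝ → ℝ} (hN : SolvesFrenet k h ρ J N)
    (hφ : ∀ t ∈ I, HasDerivAt φ (φ' t) t) (hIJ : Set.MapsTo φ I J) :
    SolvesFrenet k h (fun t => φ' t * ρ (φ t)) I (fun t => N (φ t)) where
  zero t ht := ((hN.zero (φ t) (hIJ ht)).scomp t (hφ t ht)).congr_deriv (by module)
  one t ht := ((hN.one (φ t) (hIJ ht)).scomp t (hφ t ht)).congr_deriv (by module)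
  two t ht := ((hN.two (φ t) (hIJ ht)).scomp t (hφ t ht)).congr_deriv (by module)
  three t ht := ((hN.three (φ t) (hIJ ht)).scomp t (hφ t ht)).congr_deriv (by module)
  four t ht := ((hN.four (φ t) (hIJ ht)).scomp t (hφ t ht)).congr_deriv (by module)

theorem hasDerivAt_comb (hN : SolvesFrenet k h ρ I N) {t : ℝ} (ht : t ∈ I) {a b c : ℝ → ℝ}
    {a' b' c' : ℝ} (ha : HasDerivAt a a' t) (hb : HasDerivAt b b' t) (hc : HasDerivAt c c' t) :
    HasDerivAt (fun s => a s • N s 0 + b s • N s 1 + c s • N s 4)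
      ((a' - b t * ρ t * h) • N t 0 + (a t * ρ t + b' + c t * ρ t * h) • N t 1 +
        (c' - b t * ρ t) • N t 4 + (c t * ρ t) • N t 2) t := by
  refine (((ha.smul (hN.zero t ht)).add (hb.smul (hN.one t ht))).add
    (hc.smul (hN.four t ht))).congr_deriv ?_
  module

end SolvesFrenet

/-! ### Oriented null lines and points of the Einstein universe -/

/-- The Euclidean norm of the timelike part of a vector. -/
noncomputable def timeNorm (x : R23) : ℝ := √(x 0 ^ 2 + x 1 ^ 2)

theorem SameOrientedLine.eq_smul {x y : R23} (hx : x ∈ einsteinUniverse)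
    (h : SameOrientedLine x y) : 0 < timeNorm y ∧ x = (timeNorm y)⁻¹ • y := by
  obtain ⟨r, hr, rfl⟩ := h
  have : timeNorm (r • x) = r := by
    rw [timeNorm, ← Real.sqrt_sq hr.le]
    congr 1
    simp only [Pi.smul_apply, smul_eq_mul, Real.sqrt_sq hr.le]
    linear_combination r ^ 2 * hx.1
  rw [this]
  exact ⟨hr, by rw [smul_smul, inv_mul_cancel₀ hr.ne', one_smul]⟩

theorem timeNorm_pos {y : R23} (hy : scalarProd y y = 0) (h0 : y ≠ 0) : 0 < timeNorm y := by
  apply Real.sqrt_pos.2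
  rw [scalarProd_apply] at hy
  by_contra hle
  apply h0
  have z : ∀ i, y i = 0 := by
    intro i
    have := sq_nonneg (y 0)
    have := sq_nonneg (y 1)
    have := sq_nonneg (y 2)
    have := sq_nonneg (y 3)
    have := sq_nonneg (y 4)
    have : y i ^ 2 = 0 := by fin_cases i <;> simp <;> nlinarith
    exact pow_eq_zero_iff two_ne_zero |>.1 this
  exact funext z

theorem inv_timeNorm_smul_mem {y : R23} (hy : scalarProd y y = 0) (h0 : 0 < timeNorm y) :
    (timeNorm y)⁻¹ • y ∈ einsteinUniverse := by
  have h : timeNorm y ^ 2 = y 0 ^ 2 + y 1 ^ 2 := Real.sq_sqrt (by positivity)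
  rw [scalarProd_apply] at hy
  constructor <;> simp only [Pi.smul_apply, smul_eq_mul] <;> field_simp <;> linarith

/-! ### The strain density of a curve with a given frame -/

/-- `W = ⟨N₀, N₁, N₄⟩` and its orthogonal complement are complementary. -/
theorem isCompl_orthogonal_span {N : Fin 5 → R23} (hN : gram N = mobiusGram) :
    IsCompl (scalarProd.orthogonal (Submodule.span ℝ {N 0, N 1, N 4}))
      (Submodule.span ℝ {N 0, N 1, N 4}) := by
  have g := scalarProd_of_gram hN
  constructor
  · rw [Submodule.disjoint_def]
    intro x hx hx'
    rw [LinearMap.BilinForm.mem_orthogonal_iff] at hx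
    obtain ⟨a, b, c, rfl⟩ := Submodule.mem_span_triple.1 hx'
    have e0 : scalarProd (N 0) _ = 0 := hx (N 0) (Submodule.subset_span (by simp))
    have e1 : scalarProd (N 1) _ = 0 := hx (N 1) (Submodule.subset_span (by simp))
    have e4 : scalarProd (N 4) _ = 0 := hx (N 4) (Submodule.subset_span (by simp))
    simp [g, mobiusGram] at e0 e1 e4
    simp [e0, e1, e4]
  · rw [codisjoint_iff, eq_top_iff]
    intro x _
    rw [expand_mobius hN x]
    refine Submodule.mem_sup.2 ⟨scalarProd x (N 2) • N 2 + scalarProd x (N 3) • N 3, ?_,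
      (-scalarProd x (N 4)) • N 0 + (-scalarProd x (N 1)) • N 1 + (-scalarProd x (N 0)) • N 4,
      Submodule.mem_span_triple.2 ⟨_, _, _, rfl⟩, by abel⟩
    rw [LinearMap.BilinForm.mem_orthogonal_iff]
    intro y hy
    obtain ⟨a, b, c, rfl⟩ := Submodule.mem_span_triple.1 hy
    simp [g, mobiusGram]

theorem normalProj_eq {γ : ℝ → R23} {t : ℝ} {N : Fin 5 → R23} (hN : gram N = mobiusGram)
    (hW : osculatingSpace γ t = Submodule.span ℝ {N 0, N 1, N 4}) (a b c d : ℝ) :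
    normalProj γ t (a • N 0 + b • N 1 + c • N 4 + d • N 2) = d • N 2 := by
  have g := scalarProd_of_gram hN
  have hC : IsCompl (normalSpace γ t) (osculatingSpace γ t) := by
    rw [normalSpace, hW]
    exact isCompl_orthogonal_span hN
  have h1 : a • N 0 + b • N 1 + c • N 4 ∈ osculatingSpace γ t := by
    rw [hW]
    exact Submodule.mem_span_triple.2 ⟨_, _, _, rfl⟩
  have h2 : d • N 2 ∈ normalSpace γ t := by
    rw [normalSpace, hW, LinearMap.BilinForm.mem_orthogonal_iff]
    intro y hy
    obtain ⟨a, b, c, rfl⟩ := Submodule.mem_span_triple.1 hy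
    simp [g, mobiusGram]
  rw [normalProj, dif_pos hC, map_add, Submodule.projection_apply_of_mem_right hC h1,
    Submodule.projection_apply_of_mem_left hC h2, zero_add]

/-- `N` is a family of Möbius bases along `γ : I → ℰ^{1,2}`, with `N₀` on the oriented line of `γ`,
that solves the Frenet equations with constant curvatures `k`, `h` and some smooth speed `ρ`. -/
structure IsAdaptedFrame (γ : ℝ → R23) (I : Set ℝ) (N : ℝ → Fin 5 → R23) (ρ : ℝ → ℝ) (k h : ℝ) :
    Prop where
  isOpen : IsOpen I
  mem : ∀ t ∈ I, γ t ∈ einsteinUniverse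
  smooth_speed : ContDiffOn ℝ ∞ ρ I
  frenet : SolvesFrenet k h ρ I N
  mobius : ∀ t ∈ I, IsMobiusBasis (N t)
  lift : ∀ t ∈ I, SameOrientedLine (γ t) (N t 0)

theorem hasDerivAt_iteratedDeriv {γ v₁ v₂ v₃ : ℝ → R23} {I : Set ℝ} (hI : IsOpen I)
    (h₁ : ∀ t ∈ I, HasDerivAt γ (v₁ t) t) (h₂ : ∀ t ∈ I, HasDerivAt v₁ (v₂ t) t)
    (h₃ : ∀ t ∈ I, HasDerivAt v₂ (v₃ t) t) {t : ℝ} (ht : t ∈ I) :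
    iteratedDeriv 2 γ t = v₂ t ∧ iteratedDeriv 3 γ t = v₃ t := by
  have k2 : ∀ t ∈ I, iteratedDeriv 2 γ t = v₂ t := by
    intro t ht
    rw [iteratedDeriv_succ, iteratedDeriv_one]
    refine ((h₂ t ht).congr_of_eventuallyEq ?_).deriv
    filter_upwards [hI.mem_nhds ht] with s hs using (h₁ s hs).deriv
  refine ⟨k2 t ht, ?_⟩
  rw [iteratedDeriv_succ]
  refine ((h₃ t ht).congr_of_eventuallyEq ?_).deriv
  filter_upwards [hI.mem_nhds ht] with s hs using k2 s hs

namespace IsAdaptedFrame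

variable {γ : ℝ → R23} {I : Set ℝ} {N : ℝ → Fin 5 → R23} {ρ : ℝ → ℝ} {k h : ℝ}

theorem eq_smul (hN : IsAdaptedFrame γ I N ρ k h) {t : ℝ} (ht : t ∈ I) :
    0 < timeNorm (N t 0) ∧ γ t = (timeNorm (N t 0))⁻¹ • N t 0 :=
  (hN.lift t ht).eq_smul (hN.mem t ht)

theorem contDiffOn_inv_timeNorm (hN : IsAdaptedFrame γ I N ρ k h) :
    ContDiffOn ℝ ∞ (fun t => (timeNorm (N t 0))⁻¹) I := by
  have hs := hN.frenet.contDiffOn hN.isOpen hN.smooth_speed 0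
  have c : ∀ a, ContDiffOn ℝ ∞ (fun t => N t 0 a) I := fun a => contDiffOn_pi.1 hs a
  refine ContDiffOn.inv (ContDiffOn.sqrt (((c 0).pow 2).add ((c 1).pow 2)) fun t ht => ?_)
    fun t ht => (hN.eq_smul ht).1.ne'
  exact (Real.sqrt_pos.1 (hN.eq_smul ht).1).ne'

theorem contDiffOn (hN : IsAdaptedFrame γ I N ρ k h) : ContDiffOn ℝ ∞ γ I :=
  (hN.contDiffOn_inv_timeNorm.smul (hN.frenet.contDiffOn hN.isOpen hN.smooth_speed 0)).congr
    fun _ ht => (hN.eq_smul ht).2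

/-- The derivatives of `γ = f N₀` up to order three in terms of the frame. -/
theorem exists_derivs (hN : IsAdaptedFrame γ I N ρ k h) {t : ℝ} (ht : t ∈ I) :
    ∃ a₁ a₂ b₂ a₃ b₃ c₃ : ℝ,
      deriv γ t = a₁ • N t 0 + ((timeNorm (N t 0))⁻¹ * ρ t) • N t 1 ∧
      iteratedDeriv 2 γ t = a₂ • N t 0 + b₂ • N t 1 +
        (-((timeNorm (N t 0))⁻¹ * ρ t ^ 2)) • N t 4 ∧
      iteratedDeriv 3 γ t = a₃ • N t 0 + b₃ • N t 1 + c₃ • N t 4 +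
        (-((timeNorm (N t 0))⁻¹ * ρ t ^ 3)) • N t 2 := by
  have hI := hN.isOpen
  set f : ℝ → ℝ := fun t => (timeNorm (N t 0))⁻¹ with hf
  have sf : ContDiffOn ℝ ∞ f I := hN.contDiffOn_inv_timeNorm
  have sρ := hN.smooth_speed
  have sd : ∀ {u : ℝ → ℝ}, ContDiffOn ℝ ∞ u I → ContDiffOn ℝ ∞ (deriv u) I := fun hu =>
    ((contDiffOn_infty_iff_deriv_of_isOpen hI).1 hu).2
  have D : ∀ {u : ℝ → ℝ}, ContDiffOn ℝ ∞ u I → ∀ t ∈ I, HasDerivAt u (deriv u t) t :=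
    fun hu t ht => ((hu.differentiableOn (by simp)).differentiableAt
      (hI.mem_nhds ht)).hasDerivAt
  set b₁ : ℝ → ℝ := fun t => f t * ρ t with hb₁
  have sb₁ : ContDiffOn ℝ ∞ b₁ I := sf.mul sρ
  set a₂ : ℝ → ℝ := fun t => deriv (deriv f) t - b₁ t * ρ t * h with ha₂
  have sa₂ : ContDiffOn ℝ ∞ a₂ I := (sd (sd sf)).sub ((sb₁.mul sρ).mul contDiffOn_const)
  set b₂ : ℝ → ℝ := fun t => deriv f t * ρ t + deriv b₁ t with hb₂
  have sb₂ : ContDiffOn ℝ ∞ b₂ I := ((sd sf).mul sρ).add (sd sb₁)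
  set c₂ : ℝ → ℝ := fun t => -(b₁ t * ρ t) with hc₂
  have sc₂ : ContDiffOn ℝ ∞ c₂ I := (sb₁.mul sρ).neg
  have h₁ : ∀ t ∈ I, HasDerivAt γ (deriv f t • N t 0 + b₁ t • N t 1 + (0 : ℝ) • N t 4) t := by
    intro t ht
    have := hN.frenet.hasDerivAt_comb ht (D sf t ht) (hasDerivAt_const t (0 : ℝ))
      (hasDerivAt_const t (0 : ℝ))
    refine (this.congr_of_eventuallyEq ?_).congr_deriv ?_
    · filter_upwards [hI.mem_nhds ht] with s hs
      rw [(hN.eq_smul hs).2]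
      simp [hf]
    · simp [hb₁]
  have h₂ : ∀ t ∈ I, HasDerivAt (fun t => deriv f t • N t 0 + b₁ t • N t 1 + (0 : ℝ) • N t 4)
      (a₂ t • N t 0 + b₂ t • N t 1 + c₂ t • N t 4) t := by
    intro t ht
    refine (hN.frenet.hasDerivAt_comb ht (D (sd sf) t ht) (D sb₁ t ht)
      (hasDerivAt_const t (0 : ℝ))).congr_deriv ?_
    simp [ha₂, hb₂, hc₂]
  have h₃ := fun t ht => hN.frenet.hasDerivAt_comb ht (D sa₂ t ht) (D sb₂ t ht) (D sc₂ t ht)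
  obtain ⟨e2, e3⟩ := hasDerivAt_iteratedDeriv hI h₁ h₂ h₃ ht
  rw [show c₂ t * ρ t = -(f t * ρ t ^ 3) by simp only [hc₂, hb₁]; ring] at e3
  refine ⟨deriv f t, a₂ t, b₂ t, _, _, _, ?_, ?_, e3⟩
  · rw [(h₁ t ht).deriv]
    simp [hb₁, hf]
  · rw [e2]
    simp only [hc₂, hb₁, hf]
    congr 2
    ring

theorem scalarProd_deriv (hN : IsAdaptedFrame γ I N ρ k h) {t : ℝ} (ht : t ∈ I) :
    scalarProd (deriv γ t) (deriv γ t) = -((timeNorm (N t 0))⁻¹ * ρ t) ^ 2 := by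
  obtain ⟨a, _, _, _, _, _, e, -, -⟩ := hN.exists_derivs ht
  have g := scalarProd_of_gram (hN.mobius t ht).gram_eq
  rw [e]
  simp [g]
  ring

theorem future_iff (hN : IsAdaptedFrame γ I N ρ k h) {t : ℝ} (ht : t ∈ I) :
    0 < γ t 0 * deriv γ t 1 - γ t 1 * deriv γ t 0 ↔ 0 < ρ t := by
  obtain ⟨a, _, _, _, _, _, e, -, -⟩ := hN.exists_derivs ht
  obtain ⟨hpos, e0⟩ := hN.eq_smul ht
  have hm := (hN.mobius t ht).timeMinor_pos
  have : γ t 0 * deriv γ t 1 - γ t 1 * deriv γ t 0 =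
      ((timeNorm (N t 0))⁻¹ ^ 2 * timeMinor (N t 0) (N t 1)) * ρ t := by
    rw [e, e0]
    simp [timeMinor]
    ring
  rw [this, mul_pos_iff_of_pos_left (by positivity)]

/-- The strain density is the speed of the frame. -/
theorem strainDensity_eq (hN : IsAdaptedFrame γ I N ρ k h) {t : ℝ} (ht : t ∈ I)
    (hρ : 0 < ρ t) : strainDensity γ t = ρ t := by
  obtain ⟨a₁, a₂, b₂, a₃, b₃, c₃, e1, e2, e3⟩ := hN.exists_derivs ht
  obtain ⟨hpos, e0⟩ := hN.eq_smul ht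
  have hsq := hN.scalarProd_deriv ht
  have hg := (hN.mobius t ht).gram_eq
  have g := scalarProd_of_gram hg
  set f := (timeNorm (N t 0))⁻¹ with hf
  have hfpos : 0 < f := inv_pos.2 hpos
  have hW : osculatingSpace γ t = Submodule.span ℝ {N t 0, N t 1, N t 4} := by
    apply le_antisymm
    · rw [osculatingSpace, Submodule.span_le]
      rintro x (rfl | rfl | rfl)
      · exact Submodule.mem_span_triple.2 ⟨f, 0, 0, by simp [e0]⟩
      · exact Submodule.mem_span_triple.2 ⟨a₁, f * ρ t, 0, by simp [e1]⟩
      · exact Submodule.mem_span_triple.2 ⟨a₂, b₂, _, e2.symm⟩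
    · rw [osculatingSpace, Submodule.span_le]
      have m0 : N t 0 ∈ Submodule.span ℝ {γ t, deriv γ t, iteratedDeriv 2 γ t} := by
        refine Submodule.mem_span_triple.2 ⟨f⁻¹, 0, 0, ?_⟩
        rw [e0, smul_smul, inv_mul_cancel₀ hfpos.ne']
        simp
      have m1 : N t 1 ∈ Submodule.span ℝ {γ t, deriv γ t, iteratedDeriv 2 γ t} := by
        have : N t 1 = (f * ρ t)⁻¹ • (deriv γ t - a₁ • N t 0) := by
          rw [e1, add_sub_cancel_left, smul_smul, inv_mul_cancel₀ (by positivity), one_smul]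
        rw [this]
        exact Submodule.smul_mem _ _ (Submodule.sub_mem _ (Submodule.subset_span (by simp))
          (Submodule.smul_mem _ _ m0))
      have m4 : N t 4 ∈ Submodule.span ℝ {γ t, deriv γ t, iteratedDeriv 2 γ t} := by
        have : N t 4 = (-(f * ρ t ^ 2))⁻¹ •
            (iteratedDeriv 2 γ t - (a₂ • N t 0 + b₂ • N t 1)) := by
          rw [e2, add_sub_cancel_left, smul_smul,
            inv_mul_cancel₀ (neg_ne_zero.2 (by positivity)), one_smul]
        rw [this]
        exact Submodule.smul_mem _ _ (Submodule.sub_mem _ (Submodule.subset_span (by simp))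
          (Submodule.add_mem _ (Submodule.smul_mem _ _ m0) (Submodule.smul_mem _ _ m1)))
      rintro x (rfl | rfl | rfl)
      exacts [m0, m1, m4]
  rw [strainDensity, e3, normalProj_eq hg hW, hsq]
  have h22 : scalarProd (N t 2) (N t 2) = 1 := by rw [g]; rfl
  have : scalarProd (-(f * ρ t ^ 3) • N t 2) (-(f * ρ t ^ 3) • N t 2) / |-(f * ρ t) ^ 2| =
      ρ t ^ 4 := by
    rw [abs_neg, abs_of_pos (by positivity)]
    simp only [map_smul, LinearMap.smul_apply, smul_eq_mul, h22]
    field_simp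
  rw [this, ← Real.rpow_natCast, ← Real.rpow_mul hρ.le]
  norm_num

theorem isGenericCurve (hN : IsAdaptedFrame γ I N ρ k h) (hc : I.OrdConnected)
    (hne : I.Nonempty) (hρ : ∀ t ∈ I, 0 < ρ t) : IsGenericCurve γ I where
  isOpen := hN.isOpen
  ordConnected := hc
  nonempty := hne
  smooth := hN.contDiffOn
  mem := hN.mem
  timelike t ht := by
    have := (hN.eq_smul ht).1
    have := hρ t ht
    rw [hN.scalarProd_deriv ht]
    exact neg_neg_of_pos (by positivity)
  future t ht := (hN.future_iff ht).2 (hρ t ht)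
  generic t ht := by
    rw [hN.strainDensity_eq ht (hρ t ht)]
    exact (hρ t ht).ne'

end IsAdaptedFrame

/-! ### Uniqueness of the canonical frame -/

theorem IsCanonicalFrame.isAdaptedFrame {γ : ℝ → R23} {I : Set ℝ} {M : ℝ → Fin 5 → R23}
    {k h : ℝ} (hM : IsCanonicalFrame γ I M (fun _ => k) (fun _ => h)) (hγ : IsTimelikeCurve γ I) :
    IsAdaptedFrame γ I M (strainDensity γ) k h := by
  have hI := hγ.isOpen
  have smooth : ∀ j, ContDiffOn ℝ ∞ (fun s => M s j) I := contDiffOn_pi.1 hM.smooth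
  have D : ∀ j, ∀ t ∈ I, HasDerivAt (fun s => M s j)
      (∑ i, (frenetMatrix k h i j * strainDensity γ t) • M t i) t := by
    intro j t ht
    rw [← hM.frenet t ht j]
    exact (((smooth j).differentiableOn (by simp)).differentiableAt (hI.mem_nhds ht)).hasDerivAt
  have hF : SolvesFrenet k h (strainDensity γ) I M := by
    constructor <;> intro t ht
    · refine (D 0 t ht).congr_deriv ?_
      simp [Fin.sum_univ_five, frenetMatrix]
    · refine (D 1 t ht).congr_deriv ?_
      simp [Fin.sum_univ_five, frenetMatrix]
      module
    · refine (D 2 t ht).congr_deriv ?_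
      simp [Fin.sum_univ_five, frenetMatrix]
      module
    · refine (D 3 t ht).congr_deriv ?_
      simp [Fin.sum_univ_five, frenetMatrix]
      module
    · refine (D 4 t ht).congr_deriv ?_
      simp [Fin.sum_univ_five, frenetMatrix]
      module
  refine ⟨hI, hγ.mem, ?_, hF, hM.mobius, hM.lift⟩
  -- the speed is `-⟨M₀', M₁⟩`
  have hs : ∀ t ∈ I, strainDensity γ t = -scalarProd (deriv (fun s => M s 0) t) (M t 1) := by
    intro t ht
    have g := scalarProd_of_gram (hM.mobius t ht).gram_eq
    rw [(hF.zero t ht).deriv]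
    simp [g]
  have s0 := ((contDiffOn_infty_iff_deriv_of_isOpen hI).1 (smooth 0)).2
  refine ContDiffOn.congr ?_ hs
  simp only [scalarProd_apply]
  have c0 : ∀ a, ContDiffOn ℝ ∞ (fun t => deriv (fun s => M s 0) t a) I := contDiffOn_pi.1 s0
  have c1 : ∀ a, ContDiffOn ℝ ∞ (fun t => M t 1 a) I := contDiffOn_pi.1 (smooth 1)
  exact ((((((c0 0).mul (c1 0)).neg.sub ((c0 1).mul (c1 1))).add ((c0 2).mul (c1 2))).add
    ((c0 3).mul (c1 3))).add ((c0 4).mul (c1 4))).neg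

/-- Two Möbius bases that differ at most in the vector of index `3` agree. -/
theorem IsMobiusBasis.ext_of_ne_three {M N : Fin 5 → R23} (hM : IsMobiusBasis M)
    (hN : IsMobiusBasis N) (h : ∀ j ≠ 3, M j = N j) : M = N := by
  have gM := scalarProd_of_gram hM.gram_eq
  set c := scalarProd (M 3) (N 3) with hc
  have h3 : M 3 = c • N 3 := by
    have := expand_mobius hN.gram_eq (M 3)
    rw [← h 0 (by decide), ← h 1 (by decide), ← h 2 (by decide), ← h 4 (by decide)] at this
    simpa [gM] using this
  have hcomb : M = comb (Matrix.diagonal ![1, 1, 1, c, 1]) N := by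
    funext j
    fin_cases j
    · simpa [comb, Fin.sum_univ_five] using h 0 (by decide)
    · simpa [comb, Fin.sum_univ_five] using h 1 (by decide)
    · simpa [comb, Fin.sum_univ_five] using h 2 (by decide)
    · simpa [comb, Fin.sum_univ_five] using h3
    · simpa [comb, Fin.sum_univ_five] using h 4 (by decide)
  have hcpos : 0 < c := by
    have := hM.orientation
    rw [hcomb, volForm_comb, Matrix.det_diagonal] at this
    simp [Fin.prod_univ_five] at this
    exact pos_of_mul_pos_left this hN.orientation.le
  have hc1 : c ^ 2 = 1 := by
    have h33 : scalarProd (M 3) (M 3) = 1 := by rw [gM]; rfl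
    have n33 : scalarProd (N 3) (N 3) = 1 := by rw [scalarProd_of_gram hN.gram_eq]; rfl
    rw [h3] at h33
    simp [n33] at h33
    linarith
  have : c = 1 := by nlinarith
  rw [this, one_smul] at h3
  funext j
  by_cases hj : j = 3
  · rw [hj, h3]
  · exact h j hj

/-- A curve has at most one adapted frame of positive speed, because the derivatives of its
normalized lift determine one frame vector after the other. -/
theorem IsAdaptedFrame.unique {γ : ℝ → R23} {I : Set ℝ} {M N : ℝ → Fin 5 → R23} {ρ σ : ℝ → ℝ}
    {k h k' h' : ℝ} (hM : IsAdaptedFrame γ I M ρ k h) (hN : IsAdaptedFrame γ I N σ k' h')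
    (hρ : ∀ t ∈ I, 0 < ρ t) (hσ : ∀ t ∈ I, 0 < σ t) {t : ℝ} (ht : t ∈ I) :
    M t = N t ∧ k = k' ∧ h = h' := by
  have hI := hM.isOpen
  have hsp : ∀ s ∈ I, ρ s = σ s := fun s hs => by
    rw [← hM.strainDensity_eq hs (hρ s hs), hN.strainDensity_eq hs (hσ s hs)]
  have D : ∀ i, (∀ s ∈ I, M s i = N s i) → ∀ {s}, s ∈ I → ∀ {v w : R23},
      HasDerivAt (fun s => M s i) v s → HasDerivAt (fun s => N s i) w s → v = w := by
    intro i hi s hs v w hv hw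
    refine hv.unique (hw.congr_of_eventuallyEq ?_)
    filter_upwards [hI.mem_nhds hs] with u hu using hi u hu
  have h0 : ∀ s ∈ I, M s 0 = N s 0 := by
    intro s hs
    obtain ⟨p1, e1⟩ := hM.eq_smul hs
    obtain ⟨p2, e2⟩ := hN.eq_smul hs
    have e := hM.scalarProd_deriv hs
    rw [hN.scalarProd_deriv hs, ← hsp s hs, neg_inj, mul_pow, mul_pow,
      mul_left_inj' (pow_ne_zero 2 (hρ s hs).ne'),
      sq_eq_sq₀ (inv_pos.2 p2).le (inv_pos.2 p1).le] at e
    rw [e1, ← e] at e2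
    exact smul_right_injective _ (inv_pos.2 p2).ne' e2
  have h1 : ∀ s ∈ I, M s 1 = N s 1 := by
    intro s hs
    have := D 0 h0 hs (hM.frenet.zero s hs) (hN.frenet.zero s hs)
    rw [← hsp s hs] at this
    exact smul_right_injective _ (hρ s hs).ne' this
  have h04 : ∀ s ∈ I, h • M s 0 + M s 4 = h' • N s 0 + N s 4 := by
    intro s hs
    have := D 1 h1 hs (hM.frenet.one s hs) (hN.frenet.one s hs)
    rw [← hsp s hs] at this
    exact smul_right_injective _ (neg_ne_zero.2 (hρ s hs).ne') this
  have hh : h = h' := by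
    have e := congrArg (fun x => scalarProd x x) (h04 t ht)
    have gM := scalarProd_of_gram (hM.mobius t ht).gram_eq
    have gN := scalarProd_of_gram (hN.mobius t ht).gram_eq
    simp [gM, gN] at e
    linarith
  have h4 : ∀ s ∈ I, M s 4 = N s 4 := by
    intro s hs
    have := h04 s hs
    rwa [hh, h0 s hs, add_right_inj] at this
  have h2 : ∀ s ∈ I, M s 2 = N s 2 := by
    intro s hs
    have := D 4 h4 hs (hM.frenet.four s hs) (hN.frenet.four s hs)
    rw [← hsp s hs] at this
    replace this := smul_right_injective _ (hρ s hs).ne' this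
    simpa [hh, h1 s hs] using this
  have hMN : M t = N t := by
    refine (hM.mobius t ht).ext_of_ne_three (hN.mobius t ht) fun j hj => ?_
    fin_cases j
    exacts [h0 t ht, h1 t ht, h2 t ht, absurd rfl hj, h4 t ht]
  refine ⟨hMN, ?_, hh⟩
  have := D 2 h2 ht (hM.frenet.two t ht) (hN.frenet.two t ht)
  rw [← hsp t ht] at this
  replace this := smul_right_injective _ (hρ t ht).ne' this
  simp only [hMN, add_right_inj] at this
  have e := congrArg (fun x => scalarProd x (N t 3)) this
  have gN := scalarProd_of_gram (hN.mobius t ht).gram_eq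
  simpa [gN] using e

/-! ### Model curves -/

/-- `E` is a moving frame of the model curves `t ↦ c B t`, in coordinates with respect to the basis
`B`: the family `∑ⱼ Eᵢⱼ(t) Bⱼ` solves the Frenet equations with curvatures `k`, `h` and constant
speed, is a Möbius basis for `t = 0` exactly if `B` is a basis of the required kind, and its first
vector is a fixed positive multiple of `c B t`. -/
structure IsModelFrame (isBasis : (Fin 5 → R23) → Prop) (c : (Fin 5 → R23) → ℝ → R23) (k h : ℝ)
    (E : ℝ → Matrix (Fin 5) (Fin 5) ℝ) : Prop where
  frenet : ∃ α : ℝ, 0 < α ∧ ∀ B, SolvesFrenet k h (fun _ => α) Set.univ fun t => comb (E t) B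
  lift : ∃ r : ℝ, 0 < r ∧ ∀ B t, comb (E t) B 0 = r • c B t
  isUnit : IsUnit (E 0).det
  isMobiusBasis_iff : ∀ B, IsMobiusBasis (comb (E 0) B) ↔ isBasis B

/-- A primitive on an interval of a smooth positive function is a change of variable. -/
theorem exists_isChangeOfVariable {I : Set ℝ} (hI : IsOpen I) (hc : I.OrdConnected) {ρ : ℝ → ℝ}
    (hρ : ContDiffOn ℝ ∞ ρ I) (hpos : ∀ t ∈ I, 0 < ρ t) {t₀ : ℝ} (ht₀ : t₀ ∈ I) :
    ∃ φ : ℝ → ℝ, φ t₀ = 0 ∧ (∀ t ∈ I, HasDerivAt φ (ρ t) t) ∧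
      IsChangeOfVariable φ I (φ '' I) := by
  have D : ∀ t ∈ I, HasDerivAt (fun t => ∫ x in t₀..t, ρ x) (ρ t) t := by
    intro t ht
    have hcont := hρ.continuousOn
    exact intervalIntegral.integral_hasDerivAt_right
      ((hcont.mono (hc.uIcc_subset ht₀ ht)).intervalIntegrable)
      (hcont.stronglyMeasurableAtFilter hI t ht) (hcont.continuousAt (hI.mem_nhds ht))
  refine ⟨fun t => ∫ x in t₀..t, ρ x, by simp, D, ?_, ?_, ?_⟩
  · rw [contDiffOn_infty_iff_deriv_of_isOpen hI]
    exact ⟨fun t ht => (D t ht).differentiableAt.differentiableWithinAt,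
      hρ.congr fun t ht => (D t ht).deriv⟩
  · intro t ht
    rw [(D t ht).deriv]
    exact (hpos t ht).ne'
  · refine Set.InjOn.bijOn_image (StrictMonoOn.injOn ?_)
    refine strictMonoOn_of_deriv_pos hc.convex
      (fun t ht => (D t ht).continuousAt.continuousWithinAt) fun t ht => ?_
    rw [(D t (interior_subset ht)).deriv]
    exact hpos t (interior_subset ht)

namespace IsModelFrame

variable {isBasis : (Fin 5 → R23) → Prop} {c : (Fin 5 → R23) → ℝ → R23} {k h : ℝ}
  {E : ℝ → Matrix (Fin 5) (Fin 5) ℝ} {γ : ℝ → R23} {I : Set ℝ} {M : ℝ → Fin 5 → R23}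

/-- A maximal curve with the curvatures of a model curve is parametrized by it. -/
theorem exists_isParametrizedBy (hE : IsModelFrame isBasis c k h E) (hγ : IsGenericCurve γ I)
    (hmax : IsMaximalCurve γ I) {ρ : ℝ → ℝ} (hM : IsAdaptedFrame γ I M ρ k h) {t₀ : ℝ}
    (ht₀ : t₀ ∈ I) :
    ∃ B φ, isBasis B ∧ φ t₀ = 0 ∧ IsParametrizedBy γ I φ (c B) := by
  obtain ⟨α, hα, hF⟩ := hE.frenet
  obtain ⟨r, hr, hlift⟩ := hE.lift
  have hc := hγ.ordConnected
  have hI := hγ.isOpen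
  have hpos : ∀ t ∈ I, 0 < ρ t := fun t ht => (hM.future_iff ht).1 (hγ.future t ht)
  obtain ⟨φ, hφ0, Dφ, hφ⟩ := exists_isChangeOfVariable hI hc
    (hM.smooth_speed.div_const α) (fun t ht => div_pos (hpos t ht) hα) ht₀
  set B := comb (E 0)⁻¹ (M t₀) with hB
  have hN0 : comb (E 0) B = M t₀ := comb_inv_comb hE.isUnit _
  set N : ℝ → Fin 5 → R23 := fun u => comb (E u) B with hN
  have hmob : ∀ u, IsMobiusBasis (N u) := fun u =>
    (hF B).isMobiusBasis isOpen_univ isPreconnected_univ (Set.mem_univ 0) (Set.mem_univ u)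
      (by rw [hN0]; exact hM.mobius t₀ ht₀)
  have hMN : ∀ t ∈ I, M t = N (φ t) := by
    intro t ht
    have h1 := (hF B).comp Dφ (Set.mapsTo_univ φ I)
    rw [show (fun t => ρ t / α * α) = ρ by funext t; field_simp] at h1
    refine hM.frenet.eqOn h1 hI hc.isPreconnected ht₀ ht (hmob _).gram_eq ?_
    rw [hφ0, hN0]
  set δ : ℝ → R23 := fun u => (timeNorm (N u 0))⁻¹ • N u 0 with hδ
  have hnorm : ∀ u, 0 < timeNorm (N u 0) ∧ scalarProd (N u 0) (N u 0) = 0 := by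
    intro u
    have g := scalarProd_of_gram (hmob u).gram_eq
    have h00 : scalarProd (N u 0) (N u 0) = 0 := by rw [g]; rfl
    refine ⟨timeNorm_pos h00 fun hz => ?_, h00⟩
    have h04 : scalarProd (N u 0) (N u 4) = -1 := by rw [g]; rfl
    simp [hz] at h04
  have hδN : IsAdaptedFrame δ Set.univ N (fun _ => α) k h :=
    ⟨isOpen_univ, fun u _ => inv_timeNorm_smul_mem (hnorm u).2 (hnorm u).1, contDiffOn_const,
      hF B, fun u _ => hmob u, fun u _ => ⟨timeNorm (N u 0), (hnorm u).1, by
        rw [hδ, smul_smul, mul_inv_cancel₀ (hnorm u).1.ne', one_smul]⟩⟩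
  have hδg := hδN.isGenericCurve Set.ordConnected_univ Set.univ_nonempty fun _ _ => hα
  have hsurj := hmax δ Set.univ (φ '' I) φ hδg (Set.subset_univ _) hφ fun t ht => by
    rw [(hM.eq_smul ht).2, hMN t ht]
  rw [hsurj] at hφ
  refine ⟨B, φ, (hE.isMobiusBasis_iff B).1 (by rw [hN0]; exact hM.mobius t₀ ht₀), hφ0, hφ,
    fun t ht => ⟨r⁻¹ * timeNorm (M t 0), mul_pos (inv_pos.2 hr) (hM.eq_smul ht).1, ?_⟩⟩
  have h1 : M t 0 = r • c B (φ t) := by rw [hMN t ht]; exact hlift B (φ t)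
  rw [(hM.eq_smul ht).2, smul_smul, mul_assoc, mul_inv_cancel₀ (hM.eq_smul ht).1.ne', mul_one, h1,
    smul_smul, inv_mul_cancel₀ hr.ne', one_smul]

/-- A curve parametrized by a model curve has the curvatures of the latter, and its canonical frame
is the frame of the model. -/
theorem eq_of_isParametrizedBy {k' h' : ℝ} (hE : IsModelFrame isBasis c k' h' E)
    (hγ : IsGenericCurve γ I) {ρ : ℝ → ℝ} (hM : IsAdaptedFrame γ I M ρ k h)
    {B : Fin 5 → R23} (hB : isBasis B) {φ : ℝ → ℝ} (hφ : IsParametrizedBy γ I φ (c B)) {t : ℝ}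
    (ht : t ∈ I) : M t = comb (E (φ t)) B ∧ k = k' ∧ h = h' := by
  obtain ⟨α, hα, hF⟩ := hE.frenet
  obtain ⟨r, hr, hlift⟩ := hE.lift
  obtain ⟨hch, hline⟩ := hφ
  have hI := hγ.isOpen
  have hsm := (contDiffOn_infty_iff_deriv_of_isOpen hI).1 hch.smooth
  have Dφ : ∀ t ∈ I, HasDerivAt φ (deriv φ t) t := fun t ht =>
    (hsm.1.differentiableAt (hI.mem_nhds ht)).hasDerivAt
  have hN : IsAdaptedFrame γ I (fun t => comb (E (φ t)) B) (fun t => deriv φ t * α) k' h' := by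
    refine ⟨hI, hγ.mem, hsm.2.mul contDiffOn_const, (hF B).comp Dφ (Set.mapsTo_univ φ I), ?_, ?_⟩
    · intro t _
      exact (hF B).isMobiusBasis isOpen_univ isPreconnected_univ (Set.mem_univ 0)
        (Set.mem_univ (φ t)) ((hE.isMobiusBasis_iff B).2 hB)
    · intro t ht
      obtain ⟨s, hs, e⟩ := hline t ht
      exact ⟨r * s, mul_pos hr hs, by rw [hlift, e, smul_smul]⟩
  exact hM.unique hN (fun t ht => (hM.future_iff ht).1 (hγ.future t ht))
    (fun t ht => (hN.future_iff ht).1 (hγ.future t ht)) ht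

/-- Uniqueness of the basis once the base point is fixed. -/
theorem existsUnique_basis (hE : IsModelFrame isBasis c k h E) (hγ : IsGenericCurve γ I)
    (hmax : IsMaximalCurve γ I) {ρ : ℝ → ℝ} (hM : IsAdaptedFrame γ I M ρ k h) {t₀ : ℝ}
    (ht₀ : t₀ ∈ I) :
    ∃! B, isBasis B ∧ ∃ φ : ℝ → ℝ, φ t₀ = 0 ∧ IsParametrizedBy γ I φ (c B) := by
  obtain ⟨B, φ, hB, hφ0, hφ⟩ := hE.exists_isParametrizedBy hγ hmax hM ht₀
  refine ⟨B, ⟨hB, φ, hφ0, hφ⟩, ?_⟩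
  rintro B' ⟨hB', ψ, hψ0, hψ⟩
  have e := (hE.eq_of_isParametrizedBy hγ hM hB hφ ht₀).1
  have e' := (hE.eq_of_isParametrizedBy hγ hM hB' hψ ht₀).1
  rw [hφ0] at e
  rw [hψ0] at e'
  exact comb_injective hE.isUnit (e'.symm.trans e)

end IsModelFrame

/-- The theorem for a family of model curves whose curvatures `(κ b, η b)` exhaust a class of
homogeneous curves, with `κ` injective. -/
theorem hasUniqueForm_of_isModelFrame {isBasis : (Fin 5 → R23) → Prop} {Ω : Set ℝ}
    {c : (Fin 5 → R23) → ℝ → ℝ → R23} {C : Set (ℝ × ℝ)} {κ η : ℝ → ℝ}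
    (hmodel : ∀ b ∈ Ω, ∃ E, IsModelFrame isBasis (fun B => c B b) (κ b) (η b) E)
    (hκ : Set.InjOn κ Ω) (hC : ∀ k h, (k, h) ∈ C → ∃ b ∈ Ω, κ b = k ∧ η b = h)
    {γ : ℝ → R23} {I : Set ℝ} (hγ : IsHomogeneousCurve C γ I) :
    HasUniqueForm isBasis Ω c γ I := by
  obtain ⟨k, h, hkh, M, hcan⟩ := hγ.curvatures
  have hgen := hγ.toIsGenericCurve
  have hM := hcan.isAdaptedFrame hgen.toIsTimelikeCurve
  obtain ⟨b, hb, rfl, rfl⟩ := hC k h hkh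
  obtain ⟨E, hE⟩ := hmodel b hb
  have huniq : ∀ b' ∈ Ω, ∀ B φ, isBasis B → IsParametrizedBy γ I φ (c B b') → b' = b := by
    intro b' hb' B φ hB hφ
    obtain ⟨E', hE'⟩ := hmodel b' hb'
    obtain ⟨t, ht⟩ := hgen.nonempty
    exact hκ hb' hb (hE'.eq_of_isParametrizedBy hgen hM hB hφ ht).2.1.symm
  constructor
  · obtain ⟨t, ht⟩ := hgen.nonempty
    obtain ⟨B, φ, hB, -, hφ⟩ := hE.exists_isParametrizedBy hgen hγ.maximal hM ht
    exact ⟨b, ⟨hb, B, φ, hB, hφ⟩, fun b' ⟨hb', B', φ', hB', hφ'⟩ =>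
      huniq b' hb' B' φ' hB' hφ'⟩
  · intro t₀ ht₀
    obtain ⟨B, ⟨hB, φ, hφ⟩, hBu⟩ := hE.existsUnique_basis hgen hγ.maximal hM ht₀
    refine ⟨(B, b), ⟨hB, hb, φ, hφ⟩, ?_⟩
    rintro ⟨B', b'⟩ ⟨hB', hb', φ', hφ0', hφ'⟩
    obtain rfl : b' = b := huniq b' hb' B' φ' hB' hφ'
    rw [hBu B' ⟨hB', φ', hφ0', hφ'⟩]

/-! ### The moving frame of a curve in terms of its derivatives -/

/-- The coordinates of the canonical frame of a curve with respect to its derivatives of order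
`0, …, 4`, if the curvatures are `k`, `h`, the speed is `α`, and the first frame vector is `r` times
the curve. It is obtained by solving the Frenet equations for `M₁, M₄, M₂, M₃`, in this order. -/
noncomputable def frameOfDerivs (k h α r : ℝ) : Matrix (Fin 5) (Fin 5) ℝ :=
  !![r, 0, 0, 0, 0;
     0, r / α, 0, 0, 0;
     0, -(2 * h * r / α), 0, -(r / α ^ 3), 0;
     -(r / k), 0, -(2 * h * r / (α ^ 2 * k)), 0, -(r / (α ^ 4 * k));
     -(h * r), 0, -(r / α ^ 2), 0, 0]

theorem det_frameOfDerivs (k h α r : ℝ) :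
    (frameOfDerivs k h α r).det = -(r ^ 5 / (α ^ 10 * k)) := by
  simp [frameOfDerivs, Matrix.det_succ_row_zero, Fin.sum_univ_succ, Fin.succAbove]
  ring

/-- A family that is linear in a solution of the Frenet equations is a solution. -/
theorem SolvesFrenet.comb {k h : ℝ} {ρ : ℝ → ℝ} {I : Set ℝ} {E : ℝ → Fin 5 → R23}
    (hE : SolvesFrenet k h ρ I E) (B : Fin 5 → R23) :
    SolvesFrenet k h ρ I fun t => ConfLorentz.comb (Matrix.of (E t)) B := by
  have key : ∀ {j : Fin 5} {v : R23} {t : ℝ}, HasDerivAt (fun s => E s j) v t →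
      HasDerivAt (fun s => ConfLorentz.comb (Matrix.of (E s)) B j) (∑ i, v i • B i) t := by
    intro j v t hj
    exact HasDerivAt.fun_sum fun i _ => (hasDerivAt_pi.1 hj i).smul_const (B i)
  constructor <;> intro t ht
  · refine (key (hE.zero t ht)).congr_deriv ?_
    simp [ConfLorentz.comb, Fin.sum_univ_five]
    module
  · refine (key (hE.one t ht)).congr_deriv ?_
    simp [ConfLorentz.comb, Fin.sum_univ_five]
    module
  · refine (key (hE.two t ht)).congr_deriv ?_
    simp [ConfLorentz.comb, Fin.sum_univ_five]
    module
  · refine (key (hE.three t ht)).congr_deriv ?_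
    simp [ConfLorentz.comb, Fin.sum_univ_five]
    module
  · refine (key (hE.four t ht)).congr_deriv ?_
    simp [ConfLorentz.comb, Fin.sum_univ_five]
    module

theorem solvesFrenet_frameOfDerivs {k h α r : ℝ} (hk : k ≠ 0) (hα : α ≠ 0)
    {x : ℝ → Fin 5 → R23}
    (h0 : ∀ t, HasDerivAt (fun s => x s 0) (x t 1) t)
    (h1 : ∀ t, HasDerivAt (fun s => x s 1) (x t 2) t)
    (h2 : ∀ t, HasDerivAt (fun s => x s 2) (x t 3) t)
    (h3 : ∀ t, HasDerivAt (fun s => x s 3) (x t 4) t)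
    (h4 : ∀ t, HasDerivAt (fun s => x s 4) (-(α ^ 2 * (2 * h + k ^ 2)) • x t 3 -
      (α ^ 4 * (1 + 2 * h * k ^ 2)) • x t 1) t) :
    SolvesFrenet k h (fun _ => α) Set.univ fun t => comb (frameOfDerivs k h α r) (x t) := by
  have key : ∀ (j : Fin 5) (t : ℝ),
      HasDerivAt (fun s => comb (frameOfDerivs k h α r) (x s) j)
        (frameOfDerivs k h α r j 0 • x t 1 + frameOfDerivs k h α r j 1 • x t 2 +
          frameOfDerivs k h α r j 2 • x t 3 + frameOfDerivs k h α r j 3 • x t 4 +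
          frameOfDerivs k h α r j 4 • (-(α ^ 2 * (2 * h + k ^ 2)) • x t 3 -
            (α ^ 4 * (1 + 2 * h * k ^ 2)) • x t 1)) t := by
    intro j t
    simp only [comb, Fin.sum_univ_five]
    set F := frameOfDerivs k h α r
    exact (((((h0 t).const_smul (F j 0)).add ((h1 t).const_smul (F j 1))).add
      ((h2 t).const_smul (F j 2))).add ((h3 t).const_smul (F j 3))).add
      ((h4 t).const_smul (F j 4))
  constructor <;> intro t _
  · refine (key 0 t).congr_deriv ?_
    simp only [comb, Fin.sum_univ_five, frameOfDerivs]
    ext i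
    simp
    field_simp
  · refine (key 1 t).congr_deriv ?_
    simp only [comb, Fin.sum_univ_five, frameOfDerivs]
    ext i
    simp
    field_simp
    ring
  · refine (key 2 t).congr_deriv ?_
    simp only [comb, Fin.sum_univ_five, frameOfDerivs]
    ext i
    simp
    field_simp
    ring
  · refine (key 3 t).congr_deriv ?_
    simp only [comb, Fin.sum_univ_five, frameOfDerivs]
    ext i
    simp
    field_simp
    ring
  · refine (key 4 t).congr_deriv ?_
    simp only [comb, Fin.sum_univ_five, frameOfDerivs]
    ext i
    simp
    field_simp
    ring

/-- The Gram matrix of the derivatives of order `0, …, 4` of a null curve whose successive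
derivatives have constant scalar products, in terms of `n = -⟨c', c'⟩`, `m = ⟨c'', c''⟩`,
`q = ⟨c''', c'''⟩` and `p = ⟨c'''', c''''⟩`. -/
def derivGram (n m q p : ℝ) : Matrix (Fin 5) (Fin 5) ℝ :=
  !![0, 0, n, 0, m;
     0, -n, 0, -m, 0;
     n, 0, m, 0, -q;
     0, -m, 0, q, 0;
     m, 0, -q, 0, p]

/-- The frame is orthonormal if the scalar products of the derivatives take the values that the
Frenet equations prescribe; that of `p` comes from the fifth-order equation of the curve. -/
theorem frameOfDerivs_mul_derivGram {k h α r n m q p : ℝ} (hk : k ≠ 0) (hα : α ≠ 0) (hr : r ≠ 0)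
    (hn : n = α ^ 2 / r ^ 2) (hm : m = -(2 * h * α ^ 2 * n))
    (hq : q = n * α ^ 4 * (1 - 4 * h ^ 2))
    (hp : p = α ^ 2 * (2 * h + k ^ 2) * q - α ^ 4 * (1 + 2 * h * k ^ 2) * m) :
    frameOfDerivs k h α r * derivGram n m q p * (frameOfDerivs k h α r)ᵀ = mobiusGram := by
  subst hp hq hm hn
  ext i j
  fin_cases i <;> fin_cases j <;>
    simp [frameOfDerivs, derivGram, mobiusGram, Matrix.mul_apply, Fin.sum_univ_five, hα, hr] <;>
    field_simp <;> ring

/-! ### Construction of model frames -/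

/-- The curve `t ↦ q₀ + t q₁ + t² q₂ + t³ q₃ + t⁴ q₄ + C(t) (q₅ + t q₆) + S(t) (q₇ + t q₈)`, where
`C, S` are the circular or the hyperbolic functions. -/
def jet (C S : ℝ → ℝ) (q : Fin 9 → R23) (t : ℝ) : R23 :=
  q 0 + t • q 1 + t ^ 2 • q 2 + t ^ 3 • q 3 + t ^ 4 • q 4 + C t • q 5 + (t * C t) • q 6 +
    S t • q 7 + (t * S t) • q 8

/-- The effect of differentiation on the coefficients of `jet`, if `C' = ε S` and `S' = C`. -/
def jetDeriv (ε : ℝ) (q : Fin 9 → R23) : Fin 9 → R23 :=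
  ![q 1, (2 : ℝ) • q 2, (3 : ℝ) • q 3, (4 : ℝ) • q 4, 0, q 6 + q 7, q 8, q 8 + ε • q 5, ε • q 6]

theorem hasDerivAt_jet {C S : ℝ → ℝ} {ε t : ℝ} (hC : HasDerivAt C (ε * S t) t)
    (hS : HasDerivAt S (C t) t) (q : Fin 9 → R23) :
    HasDerivAt (jet C S q) (jet C S (jetDeriv ε q) t) t := by
  have hi := hasDerivAt_id' t
  refine (((((((((hasDerivAt_const t (q 0)).add (hi.smul_const (q 1))).add
    ((hasDerivAt_pow 2 t).smul_const (q 2))).add ((hasDerivAt_pow 3 t).smul_const (q 3))).add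
    ((hasDerivAt_pow 4 t).smul_const (q 4))).add (hC.smul_const (q 5))).add
    ((hi.mul hC).smul_const (q 6))).add (hS.smul_const (q 7))).add
    ((hi.mul hS).smul_const (q 8))).congr_deriv ?_
  simp only [jet, jetDeriv]
  simp
  module

/-- The iterates of `jetDeriv` if `ε = ±1`. -/
theorem jetDeriv_iterate {ε : ℝ} (hε : ε ^ 2 = 1) (q : Fin 9 → R23) :
    (jetDeriv ε)^[2] q = ![(2 : ℝ) • q 2, (6 : ℝ) • q 3, (12 : ℝ) • q 4, 0, 0,
      (2 : ℝ) • q 8 + ε • q 5, ε • q 6, (2 * ε) • q 6 + ε • q 7, ε • q 8] ∧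
    (jetDeriv ε)^[3] q = ![(6 : ℝ) • q 3, (24 : ℝ) • q 4, 0, 0, 0,
      (3 * ε) • q 6 + ε • q 7, ε • q 8, (3 * ε) • q 8 + q 5, q 6] ∧
    (jetDeriv ε)^[4] q = ![(24 : ℝ) • q 4, 0, 0, 0, 0,
      (4 * ε) • q 8 + q 5, q 6, (4 : ℝ) • q 6 + q 7, q 8] ∧
    (jetDeriv ε)^[5] q = ![0, 0, 0, 0, 0,
      (5 : ℝ) • q 6 + q 7, q 8, (5 : ℝ) • q 8 + ε • q 5, ε • q 6] := by
  have hε' : ε * ε = 1 := by rw [← hε]; ring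
  have h2 : (jetDeriv ε)^[2] q = ![(2 : ℝ) • q 2, (6 : ℝ) • q 3, (12 : ℝ) • q 4, 0, 0,
      (2 : ℝ) • q 8 + ε • q 5, ε • q 6, (2 * ε) • q 6 + ε • q 7, ε • q 8] := by
    funext j
    fin_cases j <;> simp [jetDeriv] <;> module
  have h3 : (jetDeriv ε)^[3] q = ![(6 : ℝ) • q 3, (24 : ℝ) • q 4, 0, 0, 0,
      (3 * ε) • q 6 + ε • q 7, ε • q 8, (3 * ε) • q 8 + q 5, q 6] := by
    rw [Function.iterate_succ_apply', h2]
    funext j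
    fin_cases j <;> simp [jetDeriv, smul_smul, hε'] <;> module
  have h4 : (jetDeriv ε)^[4] q = ![(24 : ℝ) • q 4, 0, 0, 0, 0,
      (4 * ε) • q 8 + q 5, q 6, (4 : ℝ) • q 6 + q 7, q 8] := by
    rw [Function.iterate_succ_apply', h3]
    funext j
    fin_cases j <;> simp [jetDeriv, smul_smul, hε', mul_left_comm ε (3 : ℝ)] <;> module
  refine ⟨h2, h3, h4, ?_⟩
  rw [Function.iterate_succ_apply', h4]
  funext j
  fin_cases j <;> simp [jetDeriv, smul_smul, hε', mul_left_comm ε (4 : ℝ)] <;> module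

/-- The linear equation `x⁽⁵⁾ + A x⁽³⁾ + B x⁽¹⁾ = 0` in terms of the coefficients of a jet,
if `ε = ±1`. -/
structure JetODE (ε A B : ℝ) (q : Fin 9 → R23) : Prop where
  one : B • q 1 + (6 * A) • q 3 = 0
  two : B • q 2 + (12 * A) • q 4 = 0
  three : B • q 3 = 0
  four : B • q 4 = 0
  five : (5 + 3 * A * ε + B) • q 6 + (1 + A * ε + B) • q 7 = 0
  six : (1 + A * ε + B) • q 8 = 0
  seven : (5 + 3 * A * ε + B) • q 8 + (1 + A * ε + B) • ε • q 5 = 0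
  eight : (1 + A * ε + B) • q 6 = 0

theorem JetODE.iterate_eq {ε A B : ℝ} (hε : ε ^ 2 = 1) {q : Fin 9 → R23} (h : JetODE ε A B q) :
    (jetDeriv ε)^[5] q = -A • (jetDeriv ε)^[3] q - B • jetDeriv ε q := by
  obtain ⟨-, h3, -, h5⟩ := jetDeriv_iterate hε q
  rw [h3, h5, ← sub_eq_zero]
  have hε' : ε * ε = 1 := by rw [← hε]; ring
  obtain ⟨e1, e2, e3, e4, e5, e6, e7, e8⟩ := h
  funext j
  ext i
  have e1 := congrFun e1 i
  have e2 := congrFun e2 i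
  have e3 := congrFun e3 i
  have e4 := congrFun e4 i
  have e5 := congrFun e5 i
  have e6 := congrFun e6 i
  have e7 := congrFun e7 i
  have e8 := congrFun e8 i
  simp at e1 e2 e3 e4
  simp only [Pi.add_apply, Pi.smul_apply, smul_eq_mul, Pi.zero_apply] at e5 e6 e7 e8
  fin_cases j
  · simp [jetDeriv]
    linear_combination e1
  · simp [jetDeriv]
    linear_combination 2 * e2
  · simp [jetDeriv]
    exact e3
  · simp [jetDeriv]
    exact e4
  · simp [jetDeriv]
  · simp [jetDeriv]
    linear_combination e5
  · simp [jetDeriv]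
    linear_combination e6
  · simp [jetDeriv]
    linear_combination e7 - A * q 5 i * hε'
  · simp [jetDeriv]
    linear_combination ε * e8 - A * q 6 i * hε'

/-- The value at `0` of a jet and of its first four derivatives. -/
def jetMatrix (ε : ℝ) (q : Fin 9 → R23) : Matrix (Fin 5) (Fin 5) ℝ :=
  Matrix.of ![q 0 + q 5, q 1 + q 6 + q 7, (2 : ℝ) • q 2 + (2 : ℝ) • q 8 + ε • q 5,
    (6 : ℝ) • q 3 + (3 * ε) • q 6 + ε • q 7, (24 : ℝ) • q 4 + (4 * ε) • q 8 + q 5]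

theorem jetMatrix_apply {ε : ℝ} (hε : ε ^ 2 = 1) (q : Fin 9 → R23) (j : Fin 5) :
    jetMatrix ε q j = (jetDeriv ε)^[j] q 0 + (jetDeriv ε)^[j] q 5 := by
  obtain ⟨h2, h3, h4, -⟩ := jetDeriv_iterate hε q
  fin_cases j
  · rfl
  · change q 1 + q 6 + q 7 = q 1 + (q 6 + q 7)
    rw [add_assoc]
  · change (2 : ℝ) • q 2 + (2 : ℝ) • q 8 + ε • q 5 = (jetDeriv ε)^[2] q 0 + (jetDeriv ε)^[2] q 5
    simp [h2, add_assoc]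
  · change (6 : ℝ) • q 3 + (3 * ε) • q 6 + ε • q 7 = (jetDeriv ε)^[3] q 0 + (jetDeriv ε)^[3] q 5
    simp [h3, add_assoc]
  · change (24 : ℝ) • q 4 + (4 * ε) • q 8 + q 5 = (jetDeriv ε)^[4] q 0 + (jetDeriv ε)^[4] q 5
    simp [h4, add_assoc]

/-- The time orientation, relative to a Möbius basis, of a plane with given coordinates. -/
def mobiusTime (u v : R23) : ℝ := (u 0 + u 4) * v 1 - u 1 * (v 0 + v 4)

/-- The time orientation, relative to a Lie basis, of a plane with given coordinates. -/
def lieTime (u v : R23) : ℝ := (u 1 + u 3) * (v 0 + v 4) - (u 0 + u 4) * (v 1 + v 3)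

theorem exists_isModelFrame_of_iff {isBasis : (Fin 5 → R23) → Prop}
    {c : (Fin 5 → R23) → ℝ → R23} {G : Matrix (Fin 5) (Fin 5) ℝ} {τ : R23 → R23 → ℝ}
    (hτ : ∀ s s' u v, τ (s • u) (s' • v) = s * s' * τ u v)
    (hbasis : ∀ E : Matrix (Fin 5) (Fin 5) ℝ, E * G * Eᵀ = mobiusGram → 0 < E.det →
      0 < τ (E 0 + E 4) (E 1) → ∀ B, IsMobiusBasis (comb E B) ↔ isBasis B)
    {C S : ℝ → ℝ} {ε : ℝ} (hC : ∀ t, HasDerivAt C (ε * S t) t) (hS : ∀ t, HasDerivAt S (C t) t)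
    (hC0 : C 0 = 1) (hS0 : S 0 = 0) {k h a n : ℝ} (hk : 0 < k) (ha : 0 < a) (hn : 0 < n)
    (q : Fin 9 → R23) (hc : ∀ B t, c B t = ∑ i, jet C S q t i • B i)
    (hε : ε ^ 2 = 1) (hode : JetODE ε (a * (2 * h + k ^ 2)) (a ^ 2 * (1 + 2 * h * k ^ 2)) q)
    {X : Matrix (Fin 5) (Fin 5) ℝ} (hX : jetMatrix ε q = X)
    (hgram : X * G * Xᵀ = derivGram n (-(2 * h * a * n)) (n * a ^ 2 * (1 - 4 * h ^ 2))
      (a * (2 * h + k ^ 2) * (n * a ^ 2 * (1 - 4 * h ^ 2)) +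
        a ^ 2 * (1 + 2 * h * k ^ 2) * (2 * h * a * n)))
    (hdet : X.det < 0) (htime : 0 < τ (((1 - h) * a) • X 0 - X 2) (X 1)) :
    ∃ E, IsModelFrame isBasis c k h E := by
  set α := √a with hαdef
  set r := √(a / n) with hrdef
  have hα : 0 < α := Real.sqrt_pos.2 ha
  have hr : 0 < r := Real.sqrt_pos.2 (div_pos ha hn)
  have hα2 : α ^ 2 = a := Real.sq_sqrt ha.le
  have hr2 : r ^ 2 = a / n := Real.sq_sqrt (div_pos ha hn).le
  have hα4 : α ^ 4 = a ^ 2 := by rw [← hα2]; ring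
  set x : ℝ → Fin 5 → R23 := fun t j => jet C S ((jetDeriv ε)^[j] q) t with hx
  have D : ∀ (m : ℕ) (t : ℝ), HasDerivAt (jet C S ((jetDeriv ε)^[m] q))
      (jet C S ((jetDeriv ε)^[m + 1] q) t) t := by
    intro m t
    rw [Function.iterate_succ_apply']
    exact hasDerivAt_jet (hC t) (hS t) _
  have hF : SolvesFrenet k h (fun _ => α) Set.univ
      fun t => comb (frameOfDerivs k h α r) (x t) := by
    refine solvesFrenet_frameOfDerivs hk.ne' hα.ne' (D 0) (D 1) (D 2) (D 3) fun t => ?_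
    refine (D 4 t).congr_deriv ?_
    rw [hα2, hα4, hode.iterate_eq hε]
    simp only [hx, jet, Pi.sub_apply, Pi.smul_apply]
    simp
    module
  have hx0 : Matrix.of (x 0) = X := by
    ext j i
    rw [← hX, jetMatrix_apply hε]
    simp [hx, jet, hC0, hS0]
  set T := frameOfDerivs k h α r with hT
  have hE0 : Matrix.of (comb T (x 0)) = T * X := by rw [of_comb, hx0]
  have hdetE : 0 < (Matrix.of (comb T (x 0))).det := by
    rw [hE0, Matrix.det_mul, hT, det_frameOfDerivs]
    exact mul_pos_of_neg_of_neg (neg_neg_of_pos (by positivity)) hdet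
  refine ⟨fun t => Matrix.of (comb T (x t)), ⟨α, hα, fun B => hF.comb B⟩,
    ⟨r, hr, fun B t => ?_⟩, hdetE.ne'.isUnit, hbasis _ ?_ hdetE ?_⟩
  · rw [hc, Finset.smul_sum]
    refine Finset.sum_congr rfl fun i _ => ?_
    rw [smul_smul]
    congr 1
    simp [comb, Fin.sum_univ_five, hT, frameOfDerivs, hx]
  · rw [hE0]
    calc T * X * G * (T * X)ᵀ = T * (X * G * Xᵀ) * Tᵀ := by
          simp only [Matrix.transpose_mul, Matrix.mul_assoc]
      _ = mobiusGram := by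
          rw [hgram]
          refine frameOfDerivs_mul_derivGram hk.ne' hα.ne' hr.ne' ?_ ?_ ?_ ?_
          · rw [hα2, hr2]
            field_simp
          · rw [hα2]
          · rw [hα4]
          · rw [hα2, hα4]
            ring
  · have e1 : Matrix.of (comb T (x 0)) 1 = (r / α) • X 1 := by
      rw [← hx0]
      ext i
      simp [comb, Fin.sum_univ_five, hT, frameOfDerivs]
    have e2 : Matrix.of (comb T (x 0)) 0 + Matrix.of (comb T (x 0)) 4 =
        (r / α ^ 2) • (((1 - h) * a) • X 0 - X 2) := by
      rw [← hx0, ← hα2]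
      ext i
      simp [comb, Fin.sum_univ_five, hT, frameOfDerivs]
      field_simp
      ring
    rw [e1, e2, hτ]
    positivity

/-- A curve with coefficients `q` with respect to a Möbius basis has a model frame if its
derivatives at `0` have the scalar products prescribed by the curvatures, and the right orientation. -/
theorem exists_isModelFrame_mobius {c : (Fin 5 → R23) → ℝ → R23}
    {C S : ℝ → ℝ} {ε : ℝ} (hC : ∀ t, HasDerivAt C (ε * S t) t) (hS : ∀ t, HasDerivAt S (C t) t)
    (hC0 : C 0 = 1) (hS0 : S 0 = 0) {k h a n : ℝ} (hk : 0 < k) (ha : 0 < a) (hn : 0 < n)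
    (q : Fin 9 → R23) (hc : ∀ B t, c B t = ∑ i, jet C S q t i • B i)
    (hε : ε ^ 2 = 1) (hode : JetODE ε (a * (2 * h + k ^ 2)) (a ^ 2 * (1 + 2 * h * k ^ 2)) q)
    {X : Matrix (Fin 5) (Fin 5) ℝ} (hX : jetMatrix ε q = X)
    (hgram : X * mobiusGram * Xᵀ = derivGram n (-(2 * h * a * n)) (n * a ^ 2 * (1 - 4 * h ^ 2))
      (a * (2 * h + k ^ 2) * (n * a ^ 2 * (1 - 4 * h ^ 2)) +
        a ^ 2 * (1 + 2 * h * k ^ 2) * (2 * h * a * n)))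
    (hdet : X.det < 0) (htime : 0 < mobiusTime (((1 - h) * a) • X 0 - X 2) (X 1)) :
    ∃ E, IsModelFrame IsMobiusBasis c k h E := by
  refine exists_isModelFrame_of_iff (fun s s' u v => ?_) (fun E hE hd ht B => ?_) hC hS hC0 hS0 hk
    ha hn q hc hε hode hX hgram hdet htime
  · simp [mobiusTime]
    ring
  · refine isMobiusBasis_comb_iff hE hd ?_
    simp only [mobiusTime, Pi.add_apply] at ht
    linarith

/-- A curve with coefficients `q` with respect to a Lie basis has a model frame if its derivatives
at `0` have the scalar products prescribed by the curvatures, and the right orientation. -/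
theorem exists_isModelFrame_lie {c : (Fin 5 → R23) → ℝ → R23}
    {C S : ℝ → ℝ} {ε : ℝ} (hC : ∀ t, HasDerivAt C (ε * S t) t) (hS : ∀ t, HasDerivAt S (C t) t)
    (hC0 : C 0 = 1) (hS0 : S 0 = 0) {k h a n : ℝ} (hk : 0 < k) (ha : 0 < a) (hn : 0 < n)
    (q : Fin 9 → R23) (hc : ∀ B t, c B t = ∑ i, jet C S q t i • B i)
    (hε : ε ^ 2 = 1) (hode : JetODE ε (a * (2 * h + k ^ 2)) (a ^ 2 * (1 + 2 * h * k ^ 2)) q)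
    {X : Matrix (Fin 5) (Fin 5) ℝ} (hX : jetMatrix ε q = X)
    (hgram : X * lieGram * Xᵀ = derivGram n (-(2 * h * a * n)) (n * a ^ 2 * (1 - 4 * h ^ 2))
      (a * (2 * h + k ^ 2) * (n * a ^ 2 * (1 - 4 * h ^ 2)) +
        a ^ 2 * (1 + 2 * h * k ^ 2) * (2 * h * a * n)))
    (hdet : X.det < 0) (htime : 0 < lieTime (((1 - h) * a) • X 0 - X 2) (X 1)) :
    ∃ E, IsModelFrame IsLieBasis c k h E := by
  refine exists_isModelFrame_of_iff (fun s s' u v => ?_) (fun E hE hd ht B => ?_) hC hS hC0 hS0 hk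
    ha hn q hc hε hode hX hgram hdet htime
  · simp [lieTime]
    ring
  · refine isMobiusBasis_comb_iff_isLieBasis hE hd ?_
    simp only [lieTime, Pi.add_apply] at ht
    linarith

/-! ### The six model curves -/

/-- The model curves for a parameter `b`. The curvatures `k`, `h` are those for which the linear
equation of the curve is that of the Frenet equations, `a` is the square of the speed of the frame,
and `n = -⟨c', c'⟩` is found at `t = 0`. -/
theorem exists_isModelFrame_curve5 {b : ℝ} (hb : 1 < b) :
    ∃ E, IsModelFrame IsMobiusBasis (fun B => curve5 B b) (√b) (-(1 / (2 * b))) E := by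
  have hb0 : 0 < b := by linarith
  have hb1 : 0 < b ^ 2 - 1 := by nlinarith
  have hk : √b ^ 2 = b := Real.sq_sqrt hb0.le
  have hA : b / (b ^ 2 - 1) * (2 * -(1 / (2 * b)) + b) = 1 := by field_simp; ring
  have hB : (b / (b ^ 2 - 1)) ^ 2 * (1 + 2 * -(1 / (2 * b)) * b) = 0 := by
    rw [show 1 + 2 * -(1 / (2 * b)) * b = 0 by field_simp; ring, mul_zero]
  have hm : -(2 * -(1 / (2 * b)) * (b / (b ^ 2 - 1)) * (b ^ 2 - 1)) = 1 := by field_simp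
  have hq : (b ^ 2 - 1) * (b / (b ^ 2 - 1)) ^ 2 * (1 - 4 * (-(1 / (2 * b))) ^ 2) = 1 := by
    field_simp
    ring
  refine exists_isModelFrame_mobius (C := Real.cos) (S := Real.sin) (ε := -1)
    (a := b / (b ^ 2 - 1)) (n := b ^ 2 - 1)
    (fun t => by simpa using Real.hasDerivAt_cos t) Real.hasDerivAt_sin Real.cos_zero Real.sin_zero
    (Real.sqrt_pos.2 hb0) (by positivity) hb1
    ![![1 / 2, 0, 0, 0, 1], ![0, b, 0, 0, 0], ![-(b ^ 2 / 2), 0, 0, 0, 0], 0, 0,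
      ![0, 0, 1, 0, 0], 0, ![0, 0, 0, -1, 0], 0] (fun B t => ?_)
    (by norm_num) ?_
    (X := !![1 / 2, 0, 1, 0, 1; 0, b, 0, -1, 0; -b ^ 2, 0, -1, 0, 0; 0, 0, 0, 1, 0; 0, 0, 1, 0, 0])
    ?_ ?_ ?_ ?_
  · simp [curve5, jet, Fin.sum_univ_five]
    module
  · rw [hk, hA, hB]
    constructor <;> simp
  · ext i j
    fin_cases i <;> fin_cases j <;> simp [jetMatrix]
    ring
  · rw [hk, hA, hB, hq, hm]
    ext i j
    fin_cases i <;> fin_cases j <;>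
      simp [derivGram, mobiusGram, Matrix.mul_apply, Fin.sum_univ_five] <;> ring
  · simp [Matrix.det_succ_row_zero, Fin.sum_univ_succ, Fin.succAbove]
    positivity
  · simp [mobiusTime]
    positivity

theorem exists_isModelFrame_curve6 {b : ℝ} (hb : 0 < b) (hb1 : b < 1) :
    ∃ E, IsModelFrame IsMobiusBasis (fun B => curve6 B b) (√b) (-(1 / (2 * b))) E := by
  have hb2 : 0 < 1 - b ^ 2 := by nlinarith
  have hk : √b ^ 2 = b := Real.sq_sqrt hb.le
  have hA : b / (1 - b ^ 2) * (2 * -(1 / (2 * b)) + b) = -1 := by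
    field_simp
    ring
  have hB : (b / (1 - b ^ 2)) ^ 2 * (1 + 2 * -(1 / (2 * b)) * b) = 0 := by
    rw [show 1 + 2 * -(1 / (2 * b)) * b = 0 by field_simp; ring, mul_zero]
  have hm : -(2 * -(1 / (2 * b)) * (b / (1 - b ^ 2)) * (1 - b ^ 2)) = 1 := by field_simp
  have hq : (1 - b ^ 2) * (b / (1 - b ^ 2)) ^ 2 * (1 - 4 * (-(1 / (2 * b))) ^ 2) = -1 := by
    field_simp
    ring
  refine exists_isModelFrame_mobius (C := Real.cosh) (S := Real.sinh) (ε := 1)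
    (a := b / (1 - b ^ 2)) (n := 1 - b ^ 2)
    (fun t => by simpa using Real.hasDerivAt_cosh t) Real.hasDerivAt_sinh Real.cosh_zero
    Real.sinh_zero (Real.sqrt_pos.2 hb) (by positivity) hb2
    ![![1 / 2, 0, 0, 0, 1], ![0, 0, 0, b, 0], ![b ^ 2 / 2, 0, 0, 0, 0], 0, 0,
      ![0, 0, 1, 0, 0], 0, ![0, 1, 0, 0, 0], 0] (fun B t => ?_)
    (by norm_num) ?_
    (X := !![1 / 2, 0, 1, 0, 1; 0, 1, 0, b, 0; b ^ 2, 0, 1, 0, 0; 0, 1, 0, 0, 0; 0, 0, 1, 0, 0])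
    ?_ ?_ ?_ ?_
  · simp [curve6, jet, Fin.sum_univ_five]
    module
  · rw [hk, hA, hB]
    constructor <;> simp
  · ext i j
    fin_cases i <;> fin_cases j <;> simp [jetMatrix]
    ring
  · rw [hk, hA, hB, hq, hm]
    ext i j
    fin_cases i <;> fin_cases j <;>
      simp [derivGram, mobiusGram, Matrix.mul_apply, Fin.sum_univ_five] <;> ring
  · have : Matrix.det !![1 / 2, 0, 1, 0, 1; 0, 1, 0, b, 0; b ^ 2, 0, 1, 0, 0; 0, 1, 0, 0, 0;
        0, 0, 1, 0, 0] = -b ^ 3 := by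
      simp [Matrix.det_succ_row_zero, Fin.sum_univ_succ, Fin.succAbove]
      ring
    rw [this]
    exact neg_neg_of_pos (by positivity)
  · have h1 : 0 < b / (1 - b ^ 2) := by positivity
    have h2 : b ^ 2 < 3 / 2 * ((1 + (2 * b)⁻¹) * (b / (1 - b ^ 2))) := by
      have e : (1 + (2 * b)⁻¹) * (b / (1 - b ^ 2)) = (b + 1 / 2) / (1 - b ^ 2) := by field_simp
      rw [e, ← mul_div_assoc, lt_div_iff₀ hb2]
      nlinarith
    rw [mul_inv] at h2
    simp [mobiusTime]
    linarith

theorem exists_isModelFrame_curve7i {b : ℝ} (hb : 1 < b) :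
    ∃ E, IsModelFrame IsLieBasis (fun B => curve7i B b) (√(b ^ 2 - 1)) ((b ^ 2 + 1) / 2) E := by
  have hb0 : 0 < b := by linarith
  have hb1 : 0 < b ^ 2 - 1 := by nlinarith
  have hk : √(b ^ 2 - 1) ^ 2 = b ^ 2 - 1 := Real.sq_sqrt hb1.le
  have hσ : √(2 * (b ^ 2 - 1) / b) * √(2 * (b ^ 2 - 1) / b) = 2 * (b ^ 2 - 1) / b :=
    Real.mul_self_sqrt (by positivity)
  set σ := √(2 * (b ^ 2 - 1) / b) with hσdef
  have hσpos : 0 < σ := Real.sqrt_pos.2 (by positivity)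
  have hA : 1 / b ^ 2 * (2 * ((b ^ 2 + 1) / 2) + (b ^ 2 - 1)) = 2 := by
    field_simp
    ring
  have hB : (1 / b ^ 2) ^ 2 * (1 + 2 * ((b ^ 2 + 1) / 2) * (b ^ 2 - 1)) = 1 := by
    field_simp
    ring
  have hm : 2 * ((b ^ 2 + 1) / 2) * (1 / b ^ 2) * (2 * b) = 2 * (b ^ 2 + 1) / b := by field_simp
  have hq : 2 * b * (1 / b ^ 2) ^ 2 * (1 - 4 * ((b ^ 2 + 1) / 2) ^ 2) = -(2 * (b ^ 2 + 2) / b) := by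
    field_simp
    ring
  refine exists_isModelFrame_lie (C := Real.cos) (S := Real.sin) (ε := -1)
    (a := 1 / b ^ 2) (n := 2 * b)
    (fun t => by simpa using Real.hasDerivAt_cos t) Real.hasDerivAt_sin Real.cos_zero
    Real.sin_zero (Real.sqrt_pos.2 hb1) (by positivity) (by positivity)
    ![![0, 0, σ, 0, 0], 0, 0, 0, 0, ![(b ^ 2 - 1) / b, 0, 0, 0, 1], ![0, -(1 / b), 0, 0, 0],
      ![0, -((b ^ 2 - 1) / b), 0, -1, 0], ![-(1 / b), 0, 0, 0, 0]] (fun B t => ?_)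
    (by norm_num) ?_
    (X := !![(b ^ 2 - 1) / b, 0, σ, 0, 1; 0, -b, 0, -1, 0; -((b ^ 2 + 1) / b), 0, 0, 0, -1;
      0, (b ^ 2 + 2) / b, 0, 1, 0; (b ^ 2 + 3) / b, 0, 0, 0, 1])
    ?_ ?_ ?_ ?_
  · simp [curve7i, jet, Fin.sum_univ_five, ← hσdef]
    module
  · rw [hk, hA, hB]
    constructor <;> simp <;> norm_num
  · ext i j
    fin_cases i <;> fin_cases j <;> simp [jetMatrix] <;> field_simp <;> ring
  · rw [hk, hA, hB, hq, hm]
    ext i j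
    fin_cases i <;> fin_cases j <;>
      simp [derivGram, lieGram, Matrix.mul_apply, Fin.sum_univ_five, hσ] <;> field_simp <;> ring
  · have : Matrix.det !![(b ^ 2 - 1) / b, 0, σ, 0, 1; 0, -b, 0, -1, 0;
        -((b ^ 2 + 1) / b), 0, 0, 0, -1; 0, (b ^ 2 + 2) / b, 0, 1, 0;
        (b ^ 2 + 3) / b, 0, 0, 0, 1] = -(4 * σ / b ^ 2) := by
      simp [Matrix.det_succ_row_zero, Fin.sum_univ_succ, Fin.succAbove]
      field_simp
      ring
    rw [this]
    exact neg_neg_of_pos (by positivity)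
  · have : lieTime (((1 - (b ^ 2 + 1) / 2) * (1 / b ^ 2)) • ![(b ^ 2 - 1) / b, 0, σ, 0, 1] -
        ![-((b ^ 2 + 1) / b), 0, 0, 0, -1]) ![0, -b, 0, -1, 0] =
        (b ^ 4 + b ^ 3 + 4 * b ^ 2 + b - 1) * (b + 1) / (2 * b ^ 3) := by
      simp [lieTime]
      field_simp
      ring
    refine lt_of_lt_of_eq ?_ this.symm
    have : 0 < b ^ 4 + b ^ 3 + 4 * b ^ 2 + b - 1 := by
      have : 0 < b ^ 3 := by positivity
      have : 0 < b ^ 4 := by positivity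
      nlinarith
    positivity

theorem exists_isModelFrame_curve7ii {b : ℝ} (hb : 0 < b) :
    ∃ E, IsModelFrame IsLieBasis (fun B => curve7ii B b) (√(b ^ 2 + 1)) ((b ^ 2 - 1) / 2) E := by
  have hk : √(b ^ 2 + 1) ^ 2 = b ^ 2 + 1 := Real.sq_sqrt (by positivity)
  have hσ : √(2 * b * (1 + b ^ 2)) * √(2 * b * (1 + b ^ 2)) = 2 * b * (1 + b ^ 2) :=
    Real.mul_self_sqrt (by positivity)
  set σ := √(2 * b * (1 + b ^ 2)) with hσdef
  have hσpos : 0 < σ := Real.sqrt_pos.2 (by positivity)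
  have hA : 1 / b ^ 2 * (2 * ((b ^ 2 - 1) / 2) + (b ^ 2 + 1)) = 2 := by
    field_simp
    ring
  have hB : (1 / b ^ 2) ^ 2 * (1 + 2 * ((b ^ 2 - 1) / 2) * (b ^ 2 + 1)) = 1 := by
    field_simp
    ring
  have hm : 2 * ((b ^ 2 - 1) / 2) * (1 / b ^ 2) * (2 * b ^ 3) = 2 * b * (b ^ 2 - 1) := by
    field_simp
  have hq : 2 * b ^ 3 * (1 / b ^ 2) ^ 2 * (1 - 4 * ((b ^ 2 - 1) / 2) ^ 2) =
      -(2 * b * (b ^ 2 - 2)) := by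
    field_simp
    ring
  refine exists_isModelFrame_lie (C := Real.cos) (S := Real.sin) (ε := -1)
    (a := 1 / b ^ 2) (n := 2 * b ^ 3)
    (fun t => by simpa using Real.hasDerivAt_cos t) Real.hasDerivAt_sin Real.cos_zero
    Real.sin_zero (Real.sqrt_pos.2 (by positivity)) (by positivity) (by positivity)
    ![![0, 0, -σ, 0, 0], 0, 0, 0, 0, ![1 + b ^ 2, 0, 0, 0, b], ![0, 0, 0, 1, 0],
      ![0, -b, 0, -(1 + b ^ 2), 0], ![1, 0, 0, 0, 0]] (fun B t => ?_)
    (by norm_num) ?_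
    (X := !![1 + b ^ 2, 0, -σ, 0, b; 0, -b, 0, -b ^ 2, 0; 1 - b ^ 2, 0, 0, 0, -b;
      0, b, 0, b ^ 2 - 2, 0; b ^ 2 - 3, 0, 0, 0, b])
    ?_ ?_ ?_ ?_
  · simp [curve7ii, jet, Fin.sum_univ_five, ← hσdef]
    module
  · rw [hk, hA, hB]
    constructor <;> simp <;> norm_num
  · ext i j
    fin_cases i <;> fin_cases j <;> simp [jetMatrix] <;> ring
  · rw [hk, hA, hB, hq, hm]
    ext i j
    fin_cases i <;> fin_cases j <;>
      simp [derivGram, lieGram, Matrix.mul_apply, Fin.sum_univ_five, hσ] <;> ring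
  · have : Matrix.det !![1 + b ^ 2, 0, -σ, 0, b; 0, -b, 0, -b ^ 2, 0; 1 - b ^ 2, 0, 0, 0, -b;
        0, b, 0, b ^ 2 - 2, 0; b ^ 2 - 3, 0, 0, 0, b] = -(4 * σ * b ^ 2) := by
      simp [Matrix.det_succ_row_zero, Fin.sum_univ_succ, Fin.succAbove]
      ring
    rw [this]
    exact neg_neg_of_pos (by positivity)
  · have : lieTime (((1 - (b ^ 2 - 1) / 2) * (1 / b ^ 2)) • ![1 + b ^ 2, 0, -σ, 0, b] -
        ![1 - b ^ 2, 0, 0, 0, -b]) ![0, -b, 0, -b ^ 2, 0] =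
        (b ^ 4 + b ^ 3 + 3 * b + 3) * (b + b ^ 2) / (2 * b ^ 2) := by
      simp [lieTime]
      field_simp
      ring
    refine lt_of_lt_of_eq ?_ this.symm
    positivity

theorem exists_isModelFrame_curve9 : ∃ E, IsModelFrame IsLieBasis curve9 1 (-(1 / 2)) E := by
  refine exists_isModelFrame_lie (C := Real.cos) (S := Real.sin) (ε := -1) (a := 1) (n := 1)
    (fun t => by simpa using Real.hasDerivAt_cos t) Real.hasDerivAt_sin Real.cos_zero
    Real.sin_zero one_pos one_pos one_pos
    ![![-(1 / 8), 0, 1 / 2, 0, -1], ![0, 1 / 2, 0, 1, 0], ![1 / 4, 0, 1 / 2, 0, 0],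
      ![0, 1 / 6, 0, 0, 0], ![1 / 24, 0, 0, 0, 0], 0, 0, 0, 0] (fun B t => ?_)
    (by norm_num) ?_
    (X := !![-(1 / 8), 0, 1 / 2, 0, -1; 0, 1 / 2, 0, 1, 0; 1 / 2, 0, 1, 0, 0; 0, 1, 0, 0, 0;
      1, 0, 0, 0, 0])
    ?_ ?_ ?_ ?_
  · simp [curve9, jet, Fin.sum_univ_five]
    module
  · constructor <;> simp
  · ext i j
    fin_cases i <;> fin_cases j <;> simp [jetMatrix]
    norm_num
  · ext i j
    fin_cases i <;> fin_cases j <;>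
      simp [derivGram, lieGram, Matrix.mul_apply, Fin.sum_univ_five] <;> norm_num
  · simp [Matrix.det_succ_row_zero, Fin.sum_univ_succ, Fin.succAbove]
    norm_num
  · simp [lieTime]
    norm_num

theorem det_curve8 (β σ : ℝ) :
    Matrix.det !![1 - β ^ 2, -β, σ, -(1 - β ^ 2), β; -β ^ 2, -β, 0, -β ^ 2, -β;
      -(1 + β ^ 2), -β, 0, 1 + β ^ 2, β; -(2 + β ^ 2), -β, 0, -(2 + β ^ 2), -β;
      -(3 + β ^ 2), -β, 0, 3 + β ^ 2, β] = -(16 * β ^ 2 * σ) := by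
  rw [Matrix.det_succ_column _ 2]
  simp only [Fin.sum_univ_five, Matrix.of_apply, Matrix.cons_val, mul_zero, zero_mul, add_zero]
  simp [Matrix.det_succ_row_zero, Fin.sum_univ_succ, Fin.succAbove]
  ring

set_option maxHeartbeats 800000 in
theorem exists_isModelFrame_curve8 {b : ℝ} (hb : 0 < b) (hb1 : b < 1) :
    ∃ E, IsModelFrame IsLieBasis (fun B => curve8 B b) (√b) ((b - 2) / 2) E := by
  have hk : √b ^ 2 = b := Real.sq_sqrt hb.le
  have hσ2 : (2 * (b ^ 2 * (1 - b)) ^ (1 / 4 : ℝ)) * (2 * (b ^ 2 * (1 - b)) ^ (1 / 4 : ℝ)) =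
      4 * b * √(1 - b) := by
    have h0 : 0 ≤ 1 - b := by linarith
    have h1 : (b ^ 2 * (1 - b)) ^ (1 / 4 : ℝ) * (b ^ 2 * (1 - b)) ^ (1 / 4 : ℝ) = b * √(1 - b) := by
      rw [← Real.rpow_add (mul_pos (by positivity) (by linarith))]
      norm_num
      rw [← Real.sqrt_eq_rpow, Real.sqrt_mul (by positivity), Real.sqrt_sq hb.le]
    linear_combination 4 * h1
  have hσpos : 0 < 2 * (b ^ 2 * (1 - b)) ^ (1 / 4 : ℝ) :=
    mul_pos two_pos (Real.rpow_pos_of_pos (mul_pos (by positivity) (by linarith)) _)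
  have hβ : 0 < √(1 - b) := Real.sqrt_pos.2 (by linarith)
  have hβ2 : √(1 - b) ^ 2 = 1 - b := Real.sq_sqrt (by linarith)
  -- The identities are polynomial in `β = √(1 - b)` and `σ`, where `σ² = 4bβ`.
  simp only [funext fun B : Fin 5 → R23 => funext fun t => curve8.eq_def B b t]
  set σ := 2 * (b ^ 2 * (1 - b)) ^ (1 / 4 : ℝ) with hσdef
  set β := √(1 - b) with hβdef
  clear_value σ β
  obtain rfl : b = 1 - β ^ 2 := by linarith
  have hβ1 : β < 1 := by nlinarith
  have hA : 1 / β ^ 2 * (2 * ((1 - β ^ 2 - 2) / 2) + (1 - β ^ 2)) = -2 := by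
    field_simp
    ring
  have hB : (1 / β ^ 2) ^ 2 * (1 + 2 * ((1 - β ^ 2 - 2) / 2) * (1 - β ^ 2)) = 1 := by
    field_simp
    ring
  have hm : 2 * ((1 - β ^ 2 - 2) / 2) * (1 / β ^ 2) * (4 * β ^ 3) = -(4 * β * (1 + β ^ 2)) := by
    field_simp
    ring
  have hq : 4 * β ^ 3 * (1 / β ^ 2) ^ 2 * (1 - 4 * ((1 - β ^ 2 - 2) / 2) ^ 2) =
      -(4 * β * (2 + β ^ 2)) := by
    field_simp
    ring
  refine exists_isModelFrame_lie (C := Real.cosh) (S := Real.sinh) (ε := 1)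
    (a := 1 / β ^ 2) (n := 4 * β ^ 3)
    (fun t => by simpa using Real.hasDerivAt_cosh t) Real.hasDerivAt_sinh Real.cosh_zero
    Real.sinh_zero (Real.sqrt_pos.2 hb) (by positivity) (by positivity)
    ![![0, 0, σ, 0, 0], 0, 0, 0, 0, ![1 - β ^ 2, -β, 0, -(1 - β ^ 2), β], ![-1, 0, 0, -1, 0],
      ![1 - β ^ 2, -β, 0, 1 - β ^ 2, -β], ![-1, 0, 0, 1, 0]] (fun B t => ?_)
    (by norm_num) ?_
    (X := !![1 - β ^ 2, -β, σ, -(1 - β ^ 2), β; -β ^ 2, -β, 0, -β ^ 2, -β;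
      -(1 + β ^ 2), -β, 0, 1 + β ^ 2, β; -(2 + β ^ 2), -β, 0, -(2 + β ^ 2), -β;
      -(3 + β ^ 2), -β, 0, 3 + β ^ 2, β])
    ?_ ?_ ?_ ?_
  · simp [jet, Fin.sum_univ_five]
    rw [← Real.cosh_add_sinh, ← Real.cosh_sub_sinh]
    module
  · rw [hk, hA, hB]
    constructor <;> simp <;> norm_num
  · ext i j
    fin_cases i <;> fin_cases j <;> simp [jetMatrix] <;> ring
  · rw [hk, hA, hB, hq, hm]
    ext i j
    fin_cases i <;> fin_cases j <;>
      simp [derivGram, lieGram, Matrix.mul_apply, Fin.sum_univ_five, hσ2] <;> ring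
  · have := det_curve8 β σ
    rw [this]
    exact neg_neg_of_pos (by positivity)
  · have : lieTime (((1 - (1 - β ^ 2 - 2) / 2) * (1 / β ^ 2)) •
        ![1 - β ^ 2, -β, σ, -(1 - β ^ 2), β] - ![-(1 + β ^ 2), -β, 0, 1 + β ^ 2, β])
        ![-β ^ 2, -β, 0, -β ^ 2, -β] =
        (3 + 3 * β + β ^ 3 * (β - 1)) * (β + β ^ 2) / β ^ 2 := by
      simp [lieTime]
      field_simp
      ring
    refine lt_of_lt_of_eq ?_ this.symm
    have : 0 < 3 + 3 * β + β ^ 3 * (β - 1) := by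
      have : β ^ 3 < 1 := pow_lt_one₀ hβ.le hβ1 (by norm_num)
      nlinarith [pow_pos hβ 3]
    positivity

end ConfLorentz

theorem theorem9 (γ : ℝ → ConfLorentz.R23) (I : Set ℝ) :
    (ConfLorentz.IsHomogeneousCurve ConfLorentz.C5 γ I →
      ConfLorentz.HasUniqueForm ConfLorentz.IsMobiusBasis (Set.Ioi 1) ConfLorentz.curve5 γ I) ∧
    (ConfLorentz.IsHomogeneousCurve ConfLorentz.C6 γ I →
      ConfLorentz.HasUniqueForm ConfLorentz.IsMobiusBasis (Set.Ioo 0 1) ConfLorentz.curve6 γ I) ∧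
    (ConfLorentz.IsHomogeneousCurve ConfLorentz.C7i γ I →
      ConfLorentz.HasUniqueForm ConfLorentz.IsLieBasis (Set.Ioi 1) ConfLorentz.curve7i γ I) ∧
    (ConfLorentz.IsHomogeneousCurve ConfLorentz.C7ii γ I →
      ConfLorentz.HasUniqueForm ConfLorentz.IsLieBasis (Set.Ioi 0) ConfLorentz.curve7ii γ I) ∧
    (ConfLorentz.IsHomogeneousCurve ConfLorentz.C8 γ I →
      ConfLorentz.HasUniqueForm ConfLorentz.IsLieBasis (Set.Ioo 0 1) ConfLorentz.curve8 γ I) ∧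
    (ConfLorentz.IsHomogeneousCurve ConfLorentz.C9 γ I →
      ∀ t₀ ∈ I, ∃! B : Fin 5 → ConfLorentz.R23, ConfLorentz.IsLieBasis B ∧
        ∃ φ : ℝ → ℝ, φ t₀ = 0 ∧
          ConfLorentz.IsParametrizedBy γ I φ (ConfLorentz.curve9 B)) := by
  refine ⟨?_, ?_, ?_, ?_, ?_, ?_⟩
  · refine ConfLorentz.hasUniqueForm_of_isModelFrame
      (fun b hb => ConfLorentz.exists_isModelFrame_curve5 hb) ?_ ?_
    · intro b hb b' hb' h
      exact (Real.sqrt_inj (zero_le_one.trans (le_of_lt hb)) (zero_le_one.trans (le_of_lt hb'))).1 h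
    · rintro k h ⟨hk, hh⟩
      simp only at hk hh
      exact ⟨k ^ 2, one_lt_pow₀ hk two_ne_zero, Real.sqrt_sq (by linarith), hh.symm⟩
  · refine ConfLorentz.hasUniqueForm_of_isModelFrame
      (fun b hb => ConfLorentz.exists_isModelFrame_curve6 hb.1 hb.2) ?_ ?_
    · intro b hb b' hb' h
      exact (Real.sqrt_inj hb.1.le hb'.1.le).1 h
    · rintro k h ⟨hk, hk1, hh⟩
      simp only at hk hk1 hh
      exact ⟨k ^ 2, ⟨by positivity, pow_lt_one₀ hk.le hk1 two_ne_zero⟩, Real.sqrt_sq hk.le,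
        hh.symm⟩
  · refine ConfLorentz.hasUniqueForm_of_isModelFrame
      (fun b hb => ConfLorentz.exists_isModelFrame_curve7i hb) ?_ ?_
    · intro b hb b' hb' h
      have hb1 : (1 : ℝ) < b := hb
      have hb1' : (1 : ℝ) < b' := hb'
      have := (Real.sqrt_inj (by nlinarith) (by nlinarith)).1 h
      nlinarith
    · rintro k h ⟨hk, hh⟩
      simp only at hk hh
      have hsq : √(k ^ 2 + 1) ^ 2 = k ^ 2 + 1 := Real.sq_sqrt (by positivity)
      refine ⟨√(k ^ 2 + 1), ?_, ?_, ?_⟩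
      · exact Real.lt_sqrt_of_sq_lt (by nlinarith)
      · simp only [hsq, add_sub_cancel_right]
        exact Real.sqrt_sq hk.le
      · simp only [hsq]
        linarith
  · refine ConfLorentz.hasUniqueForm_of_isModelFrame
      (fun b hb => ConfLorentz.exists_isModelFrame_curve7ii hb) ?_ ?_
    · intro b hb b' hb' h
      have hb1 : (0 : ℝ) < b := hb
      have hb1' : (0 : ℝ) < b' := hb'
      have := (Real.sqrt_inj (by positivity) (by positivity)).1 h
      nlinarith
    · rintro k h ⟨hk, hh⟩
      simp only at hk hh
      have hk2 : 0 < k ^ 2 - 1 := by nlinarith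
      have hsq : √(k ^ 2 - 1) ^ 2 = k ^ 2 - 1 := Real.sq_sqrt hk2.le
      refine ⟨√(k ^ 2 - 1), Real.sqrt_pos.2 hk2, ?_, ?_⟩
      · simp only [hsq, sub_add_cancel]
        exact Real.sqrt_sq (by linarith)
      · simp only [hsq]
        linarith
  · refine ConfLorentz.hasUniqueForm_of_isModelFrame
      (fun b hb => ConfLorentz.exists_isModelFrame_curve8 hb.1 hb.2) ?_ ?_
    · intro b hb b' hb' h
      exact (Real.sqrt_inj hb.1.le hb'.1.le).1 h
    · rintro k h ⟨hk, hk1, hh⟩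
      simp only at hk hk1 hh
      refine ⟨k ^ 2, ⟨by positivity, pow_lt_one₀ hk.le hk1 two_ne_zero⟩, Real.sqrt_sq hk.le, ?_⟩
      linarith
  · intro hγ t₀ ht₀
    obtain ⟨k, h, hkh, M, hM⟩ := hγ.curvatures
    obtain ⟨rfl, rfl⟩ := Prod.mk.inj (Set.mem_singleton_iff.1 hkh)
    obtain ⟨E, hE⟩ := ConfLorentz.exists_isModelFrame_curve9
    exact hE.existsUnique_basis hγ.toIsGenericCurve hγ.maximal
      (hM.isAdaptedFrame hγ.toIsTimelikeCurve) ht₀
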